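/- **Model.** Consider a time-slotted system with one dispatcher and $N$ parallel servers with FIFO queues. In slot $t$ a random number $A_\Sigma(t)$ of jobs arrives; it is nonnegative integer valued, i.i.d. over $t$, bounded by a constant $A_{\max}$, with mean $\lambda_\Sigma$. Server $n$ offers service $S_n(t)$, nonnegative integer valued, i.i.d. over $t$, bounded by a constant $S_{\max}$, with mean $\mu_n$; services are independent across servers and independent of the arrivals. Put $\mu_\Sigma=\sum_n\mu_n$ and $\epsilon=\mu_\Sigma-\lambda_\Sigma$, where $\epsilon>0$. The state is the Markov chain $Z(t)=(\mathbf Q(t),m(t))$, where $\mathbf Q(t)$ is the vector of queue lengths and $m(t)$ is the set of server IDs stored at the dispatcher. All arrivals of slot $t$ are routed to a single queue, which is queue $n$ with probability $p_n(t)$, where $\mathbf p(t)$ is a function of $Z(t)$ (the policy); then $Q_n(t+1)=[Q_n(t)+A_n(t)-S_n(t)]^+$, where $A_n(t)$ is the number of arrivals routed to queue $n$. The resource-pooled system is the single queue $q(t+1)=[q(t)+A_\Sigma(t)-\sum_nS_n(t)]^+$. **Dispatching distributions.** Let $\sigma_t$ be a permutation with $Q_{\sigma_t(1)}(t)\le\dots\le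 Q_{\sigma_t(N)}(t)$ (any one, if there are ties), and let $P_n(t)=p_{\sigma_t(n)}(t)$ and $\Delta_n(t)=P_n(t)-\mu_{\sigma_t(n)}/\mu_\Sigma$. A probability vector $\hat{\mathbf P}$ is equivalent to $\mathbf P(t)$ in inner product if $\sum_nQ_{\sigma_t(n)}(t)\hat P_n=\sum_nQ_{\sigma_t(n)}(t)P_n(t)$. A distribution is tilted if for some $k\in\{2,\dots,N\}$ its $\Delta_n$ is $\ge0$ for $n<k$ and $\le0$ for $n\ge k$. It is $\delta$-tilted ($\delta>0$) if moreover $\Delta_1\ge\delta$ and $\Delta_N\le-\delta$. **The class $\Pi$.** A policy belongs to $\Pi$ if (i) for all $t\ge 0$ and all values of $Z(t)$, $\mathbf P(t)$ or a distribution equivalent to it in inner product is tilted; and (ii) there are constants $T\in\mathbb N$, $T\geq 1$, and $\delta>0$, independent of $\epsilon$, such that for every $k\in\mathbb N$ there is a slot $t_k\in\{kT,\dots,(k+1)T-1\}$ for which, for all values of $Z(t_k)$, $\mathbf P(t_k)$ or a distribution equivalent to it in inner product is $\delta$-tilted. **Optimality.** A policy is throughput optimal if for every $\epsilon>0$ and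 every initial distribution of the queue lengths, $\limsup_{C\to\infty}\limsup_{t\to\infty}\mathbb P(\sum_nQ_n(t)>C)=0$. It is heavy-traffic delay optimal if, for all service processes as above and all families of arrival processes as above indexed by all sufficiently small $\epsilon>0$, with mean $\mu_\Sigma-\epsilon$, a common bound $A_{\max}$, and variances that converge as $\epsilon\downarrow0$, stationary distributions of $Z^{(\epsilon)}$ and $q^{(\epsilon)}$ exist, and for stationary $\overline{\mathbf Q}^{(\epsilon)},\overline q^{(\epsilon)}$ $$\lim_{\epsilon\downarrow0}\epsilon\,\mathbb E\Big[\sum_n\overline Q^{(\epsilon)}_n\Big]=\lim_{\epsilon\downarrow0}\epsilon\,\mathbb E\big[\overline q^{(\epsilon)}\big],$$ both limits existing and being finite. **Proposition.** Let $2\le d\le N$ and let the servers be homogeneous: $\mu_n=\mu>0$ for all $n$. The power-of-$d$ policy samples $d$ of the $N$ servers uniformly at random and sends all arrivals of the slot to the shortest queue among them, ties broken uniformly at random; it uses no memory ($m(t)=\emptyset$). Let $P^*_n=\binom{N-n}{d-1}\big/\binom Nd$ for $1\le n\le N$ (so $P^*_n=0$ for $n>N-d+1$). Then: 1. if there are no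 ties in queue lengths, the sorted dispatching distribution of the policy is $\mathbf P(t)=\mathbf P^*$; 2. in every state, $\mathbf P^*$ is a probability vector equivalent to $\mathbf P(t)$ in inner product; 3. $\mathbf P^*$ is $\delta$-tilted with $\delta=1/N$; 4. the policy belongs to $\Pi$; 5. the policy is throughput optimal and heavy-traffic delay optimal. -/

import Mathlib

open MeasureTheory ProbabilityTheory Filter Topology
open scoped ENNReal

noncomputable section

namespace LoadBalancing

/-! ### The time-slotted system with one dispatcher and `N` parallel servers -/

/-- Queue lengths `Q = (Q_1, …, Q_N)`. -/
abbrev Queues (N : ℕ) : Type := Fin N → ℕ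

/-- System state `Z = (Q, m)`: queue lengths and the set of server IDs stored at the dispatcher. -/
abbrev State (N : ℕ) : Type := Queues N × Finset (Fin N)

/-- A load balancing policy. In state `z` all arrivals of the slot are routed to one server, drawn
from `dispatch z`. `update z a i q'` is the law of the next memory when, in state `z`, a batch of
`a` jobs was routed to server `i` and the next queue lengths are `q'`. `initMem q` is the law of the
initial memory when the initial queue lengths are `q`. -/
structure Policy (N : ℕ) where
  dispatch : State N → PMF (Fin N)
  update : State N → ℕ → Fin N → Queues N → PMF (Finset (Fin N))
  initMem : Queues N → PMF (Finset (Fin N))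

/-- `A` is the law of the number of exogenous arrivals in a slot: bounded by `Amax`, mean `lam`. -/
structure IsArrivalLaw (A : PMF ℕ) (lam : ℝ) (Amax : ℕ) : Prop where
  bounded : ∀ a ∈ A.support, a ≤ Amax
  mean : ∫ a, (a : ℝ) ∂A.toMeasure = lam

/-- `S` is the joint law of the offered services `(S_1, …, S_N)` in a slot: independent across
servers, bounded by `Smax`, with means `μ`. -/
structure IsServiceLaw {N : ℕ} (S : PMF (Fin N → ℕ)) (μ : Fin N → ℝ) (Smax : ℕ) : Prop where
  indep : iIndepFun (fun (n : Fin N) (s : Fin N → ℕ) => s n) S.toMeasure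
  bounded : ∀ s ∈ S.support, ∀ n, s n ≤ Smax
  mean : ∀ n, ∫ s, (s n : ℝ) ∂S.toMeasure = μ n

/-- `Q_n(t+1) = [Q_n(t) + A_n(t) - S_n(t)]⁺` when the `a` arrivals go to server `i`
(the subtraction of natural numbers is the truncated one). -/
def nextQueues {N : ℕ} (q : Queues N) (a : ℕ) (i : Fin N) (s : Fin N → ℕ) : Queues N :=
  fun n => q n + (if n = i then a else 0) - s n

/-- One-slot transition law of the Markov chain `Z(t)`: the arrivals, the services and the
dispatching decision are independent given the current state. -/
def step {N : ℕ} (P : Policy N) (A : PMF ℕ) (S : PMF (Fin N → ℕ)) (z : State N) :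
    PMF (State N) :=
  A.bind fun a => S.bind fun s => (P.dispatch z).bind fun i =>
    (P.update z a i (nextQueues z.1 a i s)).map fun m => (nextQueues z.1 a i s, m)

/-- Law of `Z(t)` when `Q(0)` has law `ν`. -/
def lawAt {N : ℕ} (P : Policy N) (A : PMF ℕ) (S : PMF (Fin N → ℕ)) (ν : PMF (Queues N)) :
    ℕ → PMF (State N)
  | 0 => ν.bind fun q => (P.initMem q).map fun m => (q, m)
  | t + 1 => (lawAt P A S ν t).bind (step P A S)

/-- One-slot transition law of the resource-pooled single-server queue,
`q(t+1) = [q(t) + A_Σ(t) - ∑ S_n(t)]⁺`. -/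
def pooledStep {N : ℕ} (A : PMF ℕ) (S : PMF (Fin N → ℕ)) (q : ℕ) : PMF ℕ :=
  A.bind fun a => S.map fun s => q + a - ∑ n, s n

/-- `π` is a stationary (steady-state) distribution of the Markov chain with transition law `K`. -/
def IsStationary {α : Type} (K : α → PMF α) (π : PMF α) : Prop := π.bind K = π

/-- Expected total queue length of a random state, as an extended nonnegative real. -/
def meanTotal {N : ℕ} (π : PMF (State N)) : ℝ≥0∞ :=
  ∑' z : State N, π z * ((∑ n, z.1 n : ℕ) : ℝ≥0∞)

/-- Expected queue length of the resource-pooled system. -/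
def meanPooled (ϖ : PMF ℕ) : ℝ≥0∞ := ∑' q : ℕ, ϖ q * (q : ℝ≥0∞)

/-! ### Throughput optimality and heavy-traffic delay optimality -/

/-- `limsup_{C → ∞} limsup_{t → ∞} ℙ(∑ Q_n(t) > C) = 0`, for the sequence `L t` of laws
of `Z(t)`. -/
def Stable {N : ℕ} (L : ℕ → PMF (State N)) : Prop :=
  limsup (fun C : ℝ => limsup (fun t : ℕ =>
    (L t).toOuterMeasure {z | C < ∑ n, (z.1 n : ℝ)}) atTop) atTop = 0

/-- Throughput optimality for servers with mean rates `μ`: the system is stable for every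
`ε > 0`, where `λ_Σ = μ_Σ - ε`, from every initial distribution of the queue lengths. -/
def ThroughputOptimal {N : ℕ} (P : Policy N) (μ : Fin N → ℝ) : Prop :=
  ∀ (S : PMF (Fin N → ℕ)) (Smax : ℕ), IsServiceLaw S μ Smax →
  ∀ ε : ℝ, 0 < ε →
  ∀ (A : PMF ℕ) (Amax : ℕ), IsArrivalLaw A (∑ n, μ n - ε) Amax →
  ∀ ν : PMF (Queues N), Stable (lawAt P A S ν)

/-- Heavy-traffic delay optimality for servers with mean rates `μ`: for all service laws and all
families of arrival laws `A ε` with `λ_Σ = μ_Σ - ε`, bounded uniformly in `ε`, whose variances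
converge as `ε ↓ 0`, both the load balancing system and the resource-pooled system have stationary
distributions, and `lim ε 𝔼[∑ Q_n] = lim ε 𝔼[q]` as `ε ↓ 0` in steady state, both limits existing
and being finite. -/
def HeavyTrafficDelayOptimal {N : ℕ} (P : Policy N) (μ : Fin N → ℝ) : Prop :=
  ∀ (S : PMF (Fin N → ℕ)) (Smax : ℕ), IsServiceLaw S μ Smax →
  ∀ (ε₀ : ℝ), 0 < ε₀ → ∀ (A : ℝ → PMF ℕ) (Amax : ℕ),
  (∀ ε ∈ Set.Ioo 0 ε₀, IsArrivalLaw (A ε) (∑ n, μ n - ε) Amax) →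
  ∀ σsq : ℝ, Tendsto (fun ε => variance (fun a : ℕ => (a : ℝ)) (A ε).toMeasure) (𝓝[>] 0)
    (𝓝 σsq) →
  (∀ ε ∈ Set.Ioo 0 ε₀, (∃ π, IsStationary (step P (A ε) S) π) ∧
    ∃ ϖ, IsStationary (pooledStep (A ε) S) ϖ) ∧
  ∀ (π : ℝ → PMF (State N)) (ϖ : ℝ → PMF ℕ),
    (∀ ε ∈ Set.Ioo 0 ε₀, IsStationary (step P (A ε) S) (π ε) ∧
      IsStationary (pooledStep (A ε) S) (ϖ ε)) →
    ∃ l : ℝ,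
      Tendsto (fun ε => ENNReal.ofReal ε * meanTotal (π ε)) (𝓝[>] 0) (𝓝 (ENNReal.ofReal l)) ∧
      Tendsto (fun ε => ENNReal.ofReal ε * meanPooled (ϖ ε)) (𝓝[>] 0) (𝓝 (ENNReal.ofReal l))

/-! ### Dispatching distributions and the class `Π`

Positions `1, …, N` are indexed by `i : Fin N`, with `n = i + 1`. -/

/-- `σ` lists the servers in nondecreasing order of queue length. -/
def IsSorting {N : ℕ} (q : Queues N) (σ : Equiv.Perm (Fin N)) : Prop :=
  Monotone fun i => q (σ i)

/-- The sorted dispatching distribution, `P_n = p_{σ(n)}`. -/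
def sortedDispatch {N : ℕ} (P : Policy N) (z : State N) (σ : Equiv.Perm (Fin N)) : Fin N → ℝ :=
  fun i => (P.dispatch z (σ i)).toReal

/-- `Δ_n = P_n - μ_{σ(n)} / μ_Σ`. -/
def Delta {N : ℕ} (μ : Fin N → ℝ) (σ : Equiv.Perm (Fin N)) (p : Fin N → ℝ) : Fin N → ℝ :=
  fun i => p i - μ (σ i) / ∑ n, μ n

/-- `p'` is a dispatching distribution equivalent to `p` in inner product. -/
def InnerEquiv {N : ℕ} (q : Queues N) (σ : Equiv.Perm (Fin N)) (p p' : Fin N → ℝ) : Prop :=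
  p' ∈ stdSimplex ℝ (Fin N) ∧ ∑ i, (q (σ i) : ℝ) * p i = ∑ i, (q (σ i) : ℝ) * p' i

/-- Tilted: for some `k ∈ {2, …, N}`, `Δ_n ≥ 0` for `n < k` and `Δ_n ≤ 0` for `n ≥ k`. -/
def Tilted {N : ℕ} (μ : Fin N → ℝ) (σ : Equiv.Perm (Fin N)) (p : Fin N → ℝ) : Prop :=
  ∃ k : ℕ, 2 ≤ k ∧ k ≤ N ∧
    (∀ i : Fin N, (i : ℕ) + 1 < k → 0 ≤ Delta μ σ p i) ∧
    (∀ i : Fin N, k ≤ (i : ℕ) + 1 → Delta μ σ p i ≤ 0)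

/-- `δ`-tilted: tilted with `Δ_1 ≥ δ` and `Δ_N ≤ -δ`, where `δ > 0`. -/
def DeltaTilted {N : ℕ} (δ : ℝ) (μ : Fin N → ℝ) (σ : Equiv.Perm (Fin N)) (p : Fin N → ℝ) :
    Prop :=
  0 < δ ∧ Tilted μ σ p ∧
    (∀ i : Fin N, (i : ℕ) + 1 = 1 → δ ≤ Delta μ σ p i) ∧
    (∀ i : Fin N, (i : ℕ) + 1 = N → Delta μ σ p i ≤ -δ)

/-- The class `Π` for servers with mean rates `μ`. "For all `Z(t)`" ranges over the states that
the system takes with positive probability in slot `t`; the constants `T` and `δ` do not depend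
on the arrivals, in particular not on `ε = μ_Σ - λ_Σ`. -/
def InPi {N : ℕ} (P : Policy N) (μ : Fin N → ℝ) : Prop :=
  (∀ (S : PMF (Fin N → ℕ)) (Smax : ℕ), IsServiceLaw S μ Smax →
    ∀ ε : ℝ, 0 < ε → ∀ (A : PMF ℕ) (Amax : ℕ), IsArrivalLaw A (∑ n, μ n - ε) Amax →
    ∀ ν : PMF (Queues N), ∀ t : ℕ, ∀ z ∈ (lawAt P A S ν t).support,
    ∀ σ : Equiv.Perm (Fin N), IsSorting z.1 σ →
      ∃ p', InnerEquiv z.1 σ (sortedDispatch P z σ) p' ∧ Tilted μ σ p') ∧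
  (∃ T : ℕ, 0 < T ∧ ∃ δ : ℝ, 0 < δ ∧
    ∀ (S : PMF (Fin N → ℕ)) (Smax : ℕ), IsServiceLaw S μ Smax →
    ∀ ε : ℝ, 0 < ε → ∀ (A : PMF ℕ) (Amax : ℕ), IsArrivalLaw A (∑ n, μ n - ε) Amax →
    ∀ ν : PMF (Queues N), ∀ k : ℕ, ∃ t : ℕ, k * T ≤ t ∧ t ≤ (k + 1) * T - 1 ∧
    ∀ z ∈ (lawAt P A S ν t).support,
    ∀ σ : Equiv.Perm (Fin N), IsSorting z.1 σ →
      ∃ p', InnerEquiv z.1 σ (sortedDispatch P z σ) p' ∧ DeltaTilted δ μ σ p')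

/-! ### The power-of-`d` policy -/

/-- The servers in `D` with the shortest queue among `D`. -/
def shortestIn {N : ℕ} (q : Queues N) (D : Finset (Fin N)) : Finset (Fin N) :=
  D.filter fun n => ∀ m ∈ D, q n ≤ q m

theorem shortestIn_nonempty {N : ℕ} (q : Queues N) {D : Finset (Fin N)} (hD : D.Nonempty) :
    (shortestIn q D).Nonempty := by
  obtain ⟨n, hn, h⟩ := D.exists_min_image q hD
  exact ⟨n, Finset.mem_filter.2 ⟨hn, h⟩⟩

/-- The possible samples: sets of `d` distinct servers. -/
abbrev Sample (N d : ℕ) : Type := {D : Finset (Fin N) // D.card = d}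

theorem sample_nonempty {N d : ℕ} (hdN : d ≤ N) : Nonempty (Sample N d) := by
  obtain ⟨D, -, hD⟩ := Finset.exists_subset_card_eq
    (s := (Finset.univ : Finset (Fin N))) (n := d) (by simpa using hdN)
  exact ⟨⟨D, hD⟩⟩

/-- Sample `d` of the `N` servers uniformly at random and choose the one with the shortest queue
among them, ties broken uniformly at random. No memory is used. -/
def powerOfD (N d : ℕ) (hd : 2 ≤ d) (hdN : d ≤ N) : Policy N where
  dispatch z :=
    haveI : Nonempty (Sample N d) := sample_nonempty hdN
    (PMF.uniformOfFintype (Sample N d)).bind fun D =>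
      PMF.uniformOfFinset (shortestIn z.1 D.1)
        (shortestIn_nonempty z.1 (Finset.card_pos.1 (by have := D.2; omega)))
  update _ _ _ _ := PMF.pure ∅
  initMem _ := PMF.pure ∅

/-- The vector with entries `C(N - n, d - 1) / C(N, d)`, `1 ≤ n ≤ N`
(zero for `n > N - d + 1`). -/
def powerOfDProb (N d : ℕ) : Fin N → ℝ :=
  fun i => ((N - ((i : ℕ) + 1)).choose (d - 1) : ℝ) / (N.choose d : ℝ)

end LoadBalancing

end

/-! Static part. Fix an order of the servers by queue length. A uniform sample of `d` servers has
its first position at `n` exactly when it consists of the `n`-th server and `d - 1` later ones, so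
`powerOfDProb` is the law of the first sampled position. Ties only move mass between servers with
equal queues; hence any function constant on ties has the same mean under the policy and under
`powerOfDProb` (`sum_sortedDispatch_mul`). This vector is antitone, starts at `d / N ≥ 2 / N` and
ends at `0`, while uniform dispatching is `1 / N`; this gives the tilt with `δ = 1 / N` and then
membership in `Π`. In terms of drift, the mean length of the queue receiving the arrivals is below
the average queue length by at least `spread / N`.

Heavy traffic. Let `ℓ` be the total queue length, `X` the net input, `u` the unused service, so that
`ℓ⁺ = ℓ + X + u`. In steady state the drifts of `ℓ` and `ℓ²` vanish: the first gives `E u = ε`, the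
second `2 ε E ℓ = E X² + E (2 u ℓ⁺ - u²)`. Since `0 ≤ u ≤ C`, `E u² ≤ C ε`. Service is unused only
at a queue that ends the slot empty, and then `ℓ⁺` is at most a multiple of spread plus constant, so
the cross term vanishes as `ε ↓ 0` once the spread has a second moment bounded uniformly in `ε`.
This state space collapse (`exists_spread_bound`) comes from the drift of the squared imbalance,
whose negative part is proportional to `λ_Σ` and not to `ε`. The pooled queue satisfies the same
identity with zero cross term, so both scaled means converge to half the limit of `E X²`. The
estimates hold for every stationary law, so uniqueness is not needed.

Existence and stability. Stationary laws come from Cesàro averages kept tight by the drift of the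
sum of squares. Stability at every time, from any initial law, uses the Lyapunov function `exp (θ
‖q‖)`, which contracts geometrically outside a ball; no irreducibility or aperiodicity enters. -/

noncomputable section

namespace LoadBalancing

/-! ### Expectations of extended nonnegative functions -/

/-- Expectation of an extended nonnegative function under a discrete law. -/
def ev {α : Type*} (p : PMF α) (f : α → ℝ≥0∞) : ℝ≥0∞ := ∑' x, p x * f x

section Ev

variable {α β : Type*}

theorem ev_bind (p : PMF α) (k : α → PMF β) (f : β → ℝ≥0∞) :
    ev (p.bind k) f = ev p fun x => ev (k x) f := by
  simp only [ev, PMF.bind_apply, ← ENNReal.tsum_mul_right, ← ENNReal.tsum_mul_left]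
  rw [ENNReal.tsum_comm]
  simp only [mul_assoc]

theorem ev_pure (x : α) (f : α → ℝ≥0∞) : ev (PMF.pure x) f = f x := by
  rw [ev, tsum_eq_single x]
  · simp
  · intro y hy
    simp [PMF.pure_apply, hy]

theorem ev_map (p : PMF α) (g : α → β) (f : β → ℝ≥0∞) :
    ev (p.map g) f = ev p fun x => f (g x) := by
  rw [PMF.map, ev_bind]
  simp only [Function.comp_apply, ev_pure]

theorem ev_mono (p : PMF α) {f g : α → ℝ≥0∞} (h : ∀ x, f x ≤ g x) : ev p f ≤ ev p g :=
  ENNReal.tsum_le_tsum fun x => mul_le_mul_right (h x) _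

theorem ev_const (p : PMF α) (c : ℝ≥0∞) : ev p (fun _ => c) = c := by
  rw [ev, ENNReal.tsum_mul_right, p.tsum_coe, one_mul]

theorem ev_add (p : PMF α) (f g : α → ℝ≥0∞) : ev p (fun x => f x + g x) = ev p f + ev p g := by
  simp only [ev, mul_add, ENNReal.tsum_add]

theorem ev_const_mul (p : PMF α) (c : ℝ≥0∞) (f : α → ℝ≥0∞) :
    ev p (fun x => c * f x) = c * ev p f := by
  simp only [ev, ← ENNReal.tsum_mul_left]
  exact tsum_congr fun x => by ring

theorem ev_eq_sum (p : PMF α) (T : Finset α) (hT : ∀ x ∈ p.support, x ∈ T) (f : α → ℝ≥0∞) :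
    ev p f = ∑ x ∈ T, p x * f x := by
  refine tsum_eq_sum fun x hx => ?_
  rw [(p.apply_eq_zero_iff x).2 fun h => hx (hT x h), zero_mul]

theorem ev_ofReal_toReal (p : PMF α) {f : α → ℝ} (hf : ∀ x, 0 ≤ f x) :
    (ev p fun x => ENNReal.ofReal (f x)).toReal = ∑' x, (p x).toReal * f x := by
  rw [ev, ENNReal.tsum_toReal_eq fun x => ENNReal.mul_ne_top (p.apply_ne_top x)
    ENNReal.ofReal_ne_top]
  exact tsum_congr fun x => by rw [ENNReal.toReal_mul, ENNReal.toReal_ofReal (hf x)]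

theorem summable_toReal (p : PMF α) : Summable fun x => (p x).toReal :=
  ENNReal.summable_toReal p.tsum_coe_ne_top

theorem hasSum_toReal (p : PMF α) : HasSum (fun x => (p x).toReal) 1 := by
  have := (summable_toReal p).hasSum
  rwa [← ENNReal.tsum_toReal_eq p.apply_ne_top, p.tsum_coe, ENNReal.toReal_one] at this

theorem summable_of_ev_ne_top (p : PMF α) {f : α → ℝ} (hf : ∀ x, 0 ≤ f x)
    (h : ev p (fun x => ENNReal.ofReal (f x)) ≠ ∞) :
    Summable fun x => (p x).toReal * f x := by
  refine (ENNReal.summable_toReal h).congr fun x => ?_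
  rw [ENNReal.toReal_mul, ENNReal.toReal_ofReal (hf x)]

theorem ev_ofReal (p : PMF α) {f : α → ℝ} (hf : ∀ x, 0 ≤ f x)
    (h : Summable fun x => (p x).toReal * f x) :
    ev p (fun x => ENNReal.ofReal (f x)) = ENNReal.ofReal (∑' x, (p x).toReal * f x) := by
  rw [ENNReal.ofReal_tsum_of_nonneg (fun x => mul_nonneg ENNReal.toReal_nonneg (hf x)) h]
  refine tsum_congr fun x => ?_
  rw [ENNReal.ofReal_mul ENNReal.toReal_nonneg, ENNReal.ofReal_toReal (p.apply_ne_top x)]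

theorem summable_of_abs_le (p : PMF α) {f g : α → ℝ} (h : ∀ x, |f x| ≤ g x)
    (hg : Summable fun x => (p x).toReal * g x) : Summable fun x => (p x).toReal * f x := by
  refine Summable.of_norm_bounded hg fun x => ?_
  rw [norm_mul, Real.norm_eq_abs, Real.norm_eq_abs, abs_of_nonneg ENNReal.toReal_nonneg]
  exact mul_le_mul_of_nonneg_left (h x) ENNReal.toReal_nonneg

/-- Both sides have total mass one, so a strict inequality anywhere would make the masses differ.
This turns subinvariance into invariance. -/
theorem PMF_eq_of_le {p q : PMF α} (h : ∀ x, p x ≤ q x) : p = q := by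
  ext x
  by_contra hne
  have := ENNReal.tsum_lt_tsum p.tsum_coe_ne_top h (lt_of_le_of_ne (h x) hne)
  rw [p.tsum_coe, q.tsum_coe] at this
  exact lt_irrefl _ this

end Ev

/-! ### Stationary distributions of Markov chains -/

section Chain

variable {α : Type} {K : α → PMF α}

theorem IsStationary.ev_eq {π : PMF α} (h : IsStationary K π) (f : α → ℝ≥0∞) :
    (ev π fun x => ev (K x) f) = ev π f := by
  rw [← ev_bind, show π.bind K = π from h]

/-- Foster–Lyapunov comparison: `K f + g ≤ f + b` implies `π g ≤ b`. -/
theorem IsStationary.ev_le {π : PMF α} (h : IsStationary K π) {f g : α → ℝ≥0∞} {b : ℝ≥0∞}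
    (hf : ∀ x, f x ≠ ∞) (hd : ∀ x, ev (K x) f + g x ≤ f x + b) : ev π g ≤ b := by
  -- `f` need not be integrable under `π`, so it is truncated at `M`. Where `f x > M` the truncation
  -- is already maximal and cannot increase, and there `g` is dropped.
  have key : ∀ M : ℝ≥0∞, M ≠ ∞ → ev π (fun x => if f x ≤ M then g x else 0) ≤ b := by
    intro M hM
    have h1 : ∀ x, ev (K x) (fun y => min (f y) M) + (if f x ≤ M then g x else 0)
        ≤ min (f x) M + b := by
      intro x
      split_ifs with hx
      · rw [min_eq_left hx]
        exact (add_le_add_left (ev_mono _ fun y => min_le_left _ _) _).trans (hd x)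
      · rw [min_eq_right (not_le.1 hx).le, add_zero]
        calc _ ≤ ev (K x) (fun _ => M) := ev_mono _ fun y => min_le_right _ _
          _ ≤ M + b := by rw [ev_const]; exact le_self_add
    have h2 := ev_mono π h1
    rw [ev_add, ev_add, h.ev_eq, ev_const] at h2
    have hfin : ev π (fun y => min (f y) M) ≠ ∞ := by
      refine ne_top_of_le_ne_top hM ?_
      calc _ ≤ ev π (fun _ => M) := ev_mono _ fun y => min_le_right _ _
        _ = M := ev_const _ _
    exact (ENNReal.add_le_add_iff_left hfin).1 h2
  rw [ev, ENNReal.tsum_eq_iSup_sum]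
  refine iSup_le fun T => ?_
  -- With `M` the sum of `f` over `T`, all of `T` lies in `{f ≤ M}`, so the restriction on `g` is
  -- inactive there.
  have hM : (∑ x ∈ T, f x) ≠ ∞ := ENNReal.sum_ne_top.2 fun x _ => hf x
  refine le_trans ?_ (key _ hM)
  refine le_trans (Finset.sum_le_sum fun x hx => ?_) (ENNReal.sum_le_tsum T)
  have hx' : f x ≤ ∑ x ∈ T, f x := Finset.single_le_sum (f := f) (fun _ _ => zero_le) hx
  simp only [if_pos hx', le_refl]

/-- The law of the chain after `t` steps. -/
def iter (K : α → PMF α) (p : PMF α) : ℕ → PMF α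
  | 0 => p
  | t + 1 => (iter K p t).bind K

theorem iter_bind {β : Type*} (p : PMF β) (k : β → PMF α) (t : ℕ) :
    iter K (p.bind k) t = p.bind fun x => iter K (k x) t := by
  induction t with
  | zero => rfl
  | succ t ih => rw [iter, ih, PMF.bind_bind]; rfl

/-- Telescoping of the drift inequality along the trajectory; it bounds the time averages of `g`. -/
theorem sum_ev_iter_le {f g : α → ℝ≥0∞} {b : ℝ≥0∞}
    (hd : ∀ x, ev (K x) f + g x ≤ f x + b) (p : PMF α) (n : ℕ) :
    ∑ t ∈ Finset.range n, ev (iter K p t) g + ev (iter K p n) f ≤ ev p f + n * b := by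
  induction n with
  | zero => simp [iter]
  | succ n ih =>
    rw [Finset.sum_range_succ]
    have h1 : ev (iter K p (n + 1)) f + ev (iter K p n) g ≤ ev (iter K p n) f + b := by
      have := ev_mono (iter K p n) hd
      rwa [ev_add, ev_add, ev_const, ← ev_bind] at this
    calc _ = ∑ t ∈ Finset.range n, ev (iter K p t) g
          + (ev (iter K p (n + 1)) f + ev (iter K p n) g) := by ring
      _ ≤ ∑ t ∈ Finset.range n, ev (iter K p t) g + (ev (iter K p n) f + b) := by gcongr
      _ = (∑ t ∈ Finset.range n, ev (iter K p t) g + ev (iter K p n) f) + b := by ring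
      _ ≤ (ev p f + n * b) + b := by gcongr
      _ = _ := by push_cast; ring

/-- Existence of a stationary distribution under a Foster–Lyapunov condition. -/
theorem exists_stationary {f g : α → ℝ≥0∞} {b : ℝ≥0∞} (hb : b ≠ ∞)
    (hd : ∀ x, ev (K x) f + g x ≤ f x + b) (x₀ : α) (hx₀ : f x₀ ≠ ∞)
    (hg : ∀ M : ℕ, {x | g x ≤ M}.Finite) : ∃ π, IsStationary K π := by
  set μ : ℕ → PMF α := iter K (PMF.pure x₀) with hμ
  -- Krylov–Bogolyubov: `c n` is the Cesàro average of the first `n + 1` laws.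
  set c : ℕ → α → ℝ≥0∞ := fun n y => (n + 1 : ℝ≥0∞)⁻¹ * ∑ t ∈ Finset.range (n + 1), μ t y with hc
  have hn0 : ∀ n : ℕ, (n + 1 : ℝ≥0∞) ≠ 0 := fun n => by positivity
  have hnt : ∀ n : ℕ, (n + 1 : ℝ≥0∞) ≠ ∞ := fun n => by finiteness
  have hcsum : ∀ n (h : α → ℝ≥0∞), ∑' y, c n y * h y
      = (n + 1 : ℝ≥0∞)⁻¹ * ∑ t ∈ Finset.range (n + 1), ev (μ t) h := by
    intro n h
    simp only [hc, mul_assoc, ENNReal.tsum_mul_left, ev, Finset.sum_mul]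
    rw [Summable.tsum_finsetSum fun _ _ => ENNReal.summable]
  have hc1 : ∀ n, ∑' y, c n y = 1 := by
    intro n
    have := hcsum n fun _ => 1
    simp only [mul_one, ev_const, Finset.sum_const, Finset.card_range, nsmul_eq_mul] at this
    rw [this]
    push_cast
    exact ENNReal.inv_mul_cancel (hn0 n) (hnt n)
  have hcg : ∀ n, ∑' y, c n y * g y ≤ f x₀ + b := by
    intro n
    rw [hcsum, ENNReal.inv_mul_le_iff (hn0 n) (hnt n)]
    have := sum_ev_iter_le hd (PMF.pure x₀) (n + 1)
    rw [ev_pure] at this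
    calc _ ≤ f x₀ + (n + 1 : ℕ) * b := le_trans le_self_add this
      _ ≤ (n + 1) * f x₀ + (n + 1) * b := by
        push_cast
        gcongr
        exact le_mul_of_one_le_left' (by simp)
      _ = _ := by ring
  -- A limit along an ultrafilter exists at every point of `[0, ∞]` at once, so no subsequence has
  -- to be extracted.
  let U : Ultrafilter ℕ := Filter.hyperfilter ℕ
  have hU : (U : Filter ℕ) ≤ atTop := Nat.hyperfilter_le_atTop
  set ψ : α → ℝ≥0∞ := fun y => (U.map fun n => c n y).lim with hψ
  have hlim : ∀ y, Tendsto (fun n => c n y) U (𝓝 (ψ y)) := fun y =>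
    (U.map fun n => c n y).le_nhds_lim
  have hle1 : ∑' y, ψ y ≤ 1 := by
    rw [ENNReal.tsum_eq_iSup_sum]
    refine iSup_le fun T => le_of_tendsto (tendsto_finsetSum T fun y _ => hlim y) ?_
    exact Eventually.of_forall fun n => (hc1 n) ▸ ENNReal.sum_le_tsum T
  -- Tightness: by Markov's inequality the averages put mass at most `(f x₀ + b) / (M + 1)` outside
  -- the finite set `{g ≤ M + 1}`, so no mass escapes in the limit.
  have hge1 : ∀ M : ℕ, 1 ≤ ∑' y, ψ y + (f x₀ + b) / (M + 1 : ℕ) := by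
    intro M
    set T := (hg (M + 1)).toFinset with hT
    have h1 : ∀ n, 1 ≤ ∑ y ∈ T, c n y + (f x₀ + b) / (M + 1 : ℕ) := by
      intro n
      have h2 : ∀ y, c n y ≤ (T : Set α).indicator (c n) y + c n y * g y / (M + 1 : ℕ) := by
        intro y
        by_cases hy : y ∈ T
        · rw [Set.indicator_of_mem (by exact_mod_cast hy)]; exact le_self_add
        · rw [Set.indicator_of_notMem (by exact_mod_cast hy), zero_add, mul_div_assoc]
          refine le_mul_of_one_le_right' ?_
          have : ¬ g y ≤ (M + 1 : ℕ) := by simpa [hT] using hy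
          rw [ENNReal.le_div_iff_mul_le (Or.inl (by simp)) (Or.inl (by finiteness)), one_mul]
          exact (not_le.1 this).le
      have h3 := ENNReal.tsum_le_tsum h2
      rw [hc1, ENNReal.tsum_add, ← Finset.tsum_subtype', tsum_subtype] at *
      refine h3.trans ?_
      gcongr
      simp only [div_eq_mul_inv, ENNReal.tsum_mul_right]
      gcongr
      exact hcg n
    refine le_trans (ge_of_tendsto ((tendsto_finsetSum T fun y _ => hlim y).add_const _)
      (Eventually.of_forall h1)) ?_
    gcongr
    exact ENNReal.sum_le_tsum T
  have hψ1 : ∑' y, ψ y = 1 := by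
    have h0 : Tendsto (fun M : ℕ => (f x₀ + b) / ((M + 1 : ℕ) : ℝ≥0∞)) atTop (𝓝 0) :=
      ((ENNReal.Tendsto.const_div ENNReal.tendsto_nat_nhds_top
        (Or.inr (by finiteness))).comp (tendsto_add_atTop_nat 1)).trans (by simp)
    have h1 := h0.const_add (∑' y, ψ y)
    rw [add_zero] at h1
    exact le_antisymm hle1 (ge_of_tendsto h1 (Eventually.of_forall hge1))
  let π : PMF α := ⟨ψ, by rw [← hψ1]; exact ENNReal.summable.hasSum⟩
  refine ⟨π, PMF_eq_of_le fun y => ?_⟩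
  rw [PMF.bind_apply, ENNReal.tsum_eq_iSup_sum]
  refine iSup_le fun T => ?_
  -- Applying `K` shifts the average by one slot, which costs at most `1 / (n + 1)`. Finite partial
  -- sums suffice, because only subinvariance of the limit is needed.
  have hstep : ∀ n : ℕ, ∑ x ∈ T, c n x * K x y ≤ c n y + (n + 1 : ℝ≥0∞)⁻¹ := by
    intro n
    refine (ENNReal.sum_le_tsum T).trans ?_
    rw [hcsum n fun x => K x y]
    have : ∀ t, ev (μ t) (fun x => K x y) = μ (t + 1) y := fun t => rfl
    simp only [this]
    calc (n + 1 : ℝ≥0∞)⁻¹ * ∑ t ∈ Finset.range (n + 1), μ (t + 1) y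
        ≤ (n + 1 : ℝ≥0∞)⁻¹ * (∑ t ∈ Finset.range (n + 1), μ t y + 1) := by
          gcongr
          calc _ ≤ ∑ t ∈ Finset.range (n + 1), μ (t + 1) y + μ 0 y := le_self_add
            _ = ∑ t ∈ Finset.range (n + 1), μ t y + μ (n + 1) y := by
              rw [← Finset.sum_range_succ' fun t => μ t y, Finset.sum_range_succ]
            _ ≤ _ := by gcongr; exact PMF.coe_le_one _ _
      _ = c n y + (n + 1 : ℝ≥0∞)⁻¹ := by rw [mul_add, mul_one]
  have hl : Tendsto (fun n : ℕ => c n y + (n + 1 : ℝ≥0∞)⁻¹) U (𝓝 (ψ y + 0)) := by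
    refine (hlim y).add (Tendsto.mono_left ?_ hU)
    have := (tendsto_add_atTop_iff_nat 1).2 ENNReal.tendsto_inv_nat_nhds_zero
    simpa using this
  rw [add_zero] at hl
  refine le_of_tendsto_of_tendsto (tendsto_finsetSum T fun x _ =>
    ENNReal.Tendsto.mul_const (hlim x) (Or.inr ((K x).apply_ne_top y))) hl
    (Eventually.of_forall hstep)

end Chain

/-! ### Chains driven by finitely many innovations -/

/-- From state `x`, the chain `K` moves to `F x ω` with probability `w x ω`, `ω ∈ O`. -/
structure FiniteRep {α Ω : Type} (K : α → PMF α) (O : Finset Ω) (w : α → Ω → ℝ)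
    (F : α → Ω → α) : Prop where
  nonneg : ∀ x, ∀ ω ∈ O, 0 ≤ w x ω
  sum_one : ∀ x, ∑ ω ∈ O, w x ω = 1
  ev_eq : ∀ x f, ev (K x) f = ∑ ω ∈ O, ENNReal.ofReal (w x ω) * f (F x ω)

namespace FiniteRep

variable {α Ω : Type} {K : α → PMF α} {O : Finset Ω} {w : α → Ω → ℝ} {F : α → Ω → α}

theorem ev_ofReal (h : FiniteRep K O w F) (x : α) {f : α → ℝ} (hf : ∀ x, 0 ≤ f x) :
    ev (K x) (fun y => ENNReal.ofReal (f y)) = ENNReal.ofReal (∑ ω ∈ O, w x ω * f (F x ω)) := by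
  rw [h.ev_eq, ENNReal.ofReal_sum_of_nonneg fun ω hω => mul_nonneg (h.nonneg x ω hω) (hf _)]
  exact Finset.sum_congr rfl fun ω hω => (ENNReal.ofReal_mul (h.nonneg x ω hω)).symm

theorem sum_mono (h : FiniteRep K O w F) (x : α) {f g : Ω → ℝ} (hfg : ∀ ω ∈ O, f ω ≤ g ω) :
    ∑ ω ∈ O, w x ω * f ω ≤ ∑ ω ∈ O, w x ω * g ω :=
  Finset.sum_le_sum fun ω hω => mul_le_mul_of_nonneg_left (hfg ω hω) (h.nonneg x ω hω)

theorem sum_const (h : FiniteRep K O w F) (x : α) (c : ℝ) : ∑ ω ∈ O, w x ω * c = c := by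
  rw [← Finset.sum_mul, h.sum_one, one_mul]

theorem abs_sum_le (h : FiniteRep K O w F) (x : α) {f : Ω → ℝ} {c : ℝ}
    (hf : ∀ ω ∈ O, |f ω| ≤ c) : |∑ ω ∈ O, w x ω * f ω| ≤ c := by
  refine (Finset.abs_sum_le_sum_abs _ _).trans ?_
  rw [← h.sum_const x c]
  refine Finset.sum_le_sum fun ω hω => ?_
  rw [abs_mul, abs_of_nonneg (h.nonneg x ω hω)]
  exact mul_le_mul_of_nonneg_left (hf ω hω) (h.nonneg x ω hω)

theorem drift_ofReal (h : FiniteRep K O w F) {f g : α → ℝ} {b : ℝ} (hf : ∀ x, 0 ≤ f x)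
    (hg : ∀ x, 0 ≤ g x) (hb : 0 ≤ b)
    (hd : ∀ x, ∑ ω ∈ O, w x ω * (f (F x ω) - f x) ≤ b - g x) (x : α) :
    ev (K x) (fun y => ENNReal.ofReal (f y)) + ENNReal.ofReal (g x)
      ≤ ENNReal.ofReal (f x) + ENNReal.ofReal b := by
  have h1 := hd x
  simp only [mul_sub, Finset.sum_sub_distrib, h.sum_const] at h1
  rw [h.ev_ofReal x hf, ← ENNReal.ofReal_add _ (hg x), ← ENNReal.ofReal_add (hf x) hb]
  · exact ENNReal.ofReal_le_ofReal (by linarith)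
  · exact Finset.sum_nonneg fun ω hω => mul_nonneg (h.nonneg x ω hω) (hf _)

/-- Foster–Lyapunov comparison for real functions. -/
theorem tsum_le (h : FiniteRep K O w F) {π : PMF α} (hπ : IsStationary K π) {f g : α → ℝ} {b : ℝ}
    (hf : ∀ x, 0 ≤ f x) (hg : ∀ x, 0 ≤ g x) (hb : 0 ≤ b)
    (hd : ∀ x, ∑ ω ∈ O, w x ω * (f (F x ω) - f x) ≤ b - g x) :
    (Summable fun x => (π x).toReal * g x) ∧ ∑' x, (π x).toReal * g x ≤ b := by
  have h1 := hπ.ev_le (fun x => ENNReal.ofReal_ne_top) (h.drift_ofReal hf hg hb hd)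
  have h2 := summable_of_ev_ne_top π hg (ne_top_of_le_ne_top ENNReal.ofReal_ne_top h1)
  refine ⟨h2, ?_⟩
  rw [LoadBalancing.ev_ofReal π hg h2] at h1
  exact (ENNReal.ofReal_le_ofReal_iff hb).1 h1

theorem exists_stationary (h : FiniteRep K O w F) {f g : α → ℝ} {b : ℝ}
    (hf : ∀ x, 0 ≤ f x) (hg : ∀ x, 0 ≤ g x) (hb : 0 ≤ b)
    (hd : ∀ x, ∑ ω ∈ O, w x ω * (f (F x ω) - f x) ≤ b - g x) (x₀ : α)
    (hfin : ∀ M : ℝ, {x | g x ≤ M}.Finite) : ∃ π, IsStationary K π := by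
  refine LoadBalancing.exists_stationary ENNReal.ofReal_ne_top (h.drift_ofReal hf hg hb hd) x₀
    ENNReal.ofReal_ne_top fun M => (hfin M).subset fun x hx => ?_
  have hx' : ENNReal.ofReal (g x) ≤ M := hx
  rwa [← ENNReal.ofReal_natCast, ENNReal.ofReal_le_ofReal_iff (Nat.cast_nonneg M)] at hx'

/-- In steady state the mean drift of `f` vanishes, if the increments of `f` are dominated by an
integrable function of the current state. -/
theorem hasSum_drift (h : FiniteRep K O w F) {π : PMF α} (hπ : IsStationary K π) {f G : α → ℝ}
    (hf : ∀ x, 0 ≤ f x) (hG : Summable fun x => (π x).toReal * G x)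
    (hinc : ∀ x, ∀ ω ∈ O, |f (F x ω) - f x| ≤ G x) :
    HasSum (fun x => (π x).toReal * ∑ ω ∈ O, w x ω * (f (F x ω) - f x)) 0 := by
  have hbd : ∀ x, |∑ ω ∈ O, w x ω * (f (F x ω) - f x)| ≤ G x := fun x =>
    h.abs_sum_le x (hinc x)
  have hs := summable_of_abs_le π hbd hG
  -- The truncation `min f M` is integrable, so its mean drift is exactly zero. Truncation does not
  -- enlarge increments, so `G` dominates and `M → ∞` is allowed even if `f` itself is not
  -- integrable.
  have hzero : ∀ M : ℕ, ∑' x, (π x).toReal *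
      ∑ ω ∈ O, w x ω * (min (f (F x ω)) M - min (f x) M) = 0 := by
    intro M
    have hM0 : ∀ x, 0 ≤ min (f x) (M : ℝ) := fun x => le_min (hf x) M.cast_nonneg
    have hMs : Summable fun x => (π x).toReal * (M : ℝ) := (summable_toReal π).mul_right _
    have hK0 : ∀ x, 0 ≤ ∑ ω ∈ O, w x ω * min (f (F x ω)) M := fun x =>
      Finset.sum_nonneg fun ω hω => mul_nonneg (h.nonneg x ω hω) (hM0 _)
    have h1 : Summable fun x => (π x).toReal * min (f x) M :=
      summable_of_abs_le π (fun x => by rw [abs_of_nonneg (hM0 x)]; exact min_le_right _ _) hMs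
    have h2 : Summable fun x => (π x).toReal * ∑ ω ∈ O, w x ω * min (f (F x ω)) M :=
      summable_of_abs_le π (fun x => h.abs_sum_le x fun ω _ => by
        rw [abs_of_nonneg (hM0 _)]; exact min_le_right _ _) hMs
    have h3 := congrArg ENNReal.toReal (hπ.ev_eq fun y => ENNReal.ofReal (min (f y) M))
    simp only [h.ev_ofReal _ hM0] at h3
    rw [ev_ofReal_toReal π hM0, ev_ofReal_toReal π hK0] at h3
    simp only [mul_sub, Finset.sum_sub_distrib, h.sum_const]
    rw [h2.tsum_sub h1, h3, sub_self]
  have hlim := tendsto_tsum_of_dominated_convergence (𝓕 := (atTop : Filter ℕ))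
    (f := fun (M : ℕ) x => (π x).toReal *
      ∑ ω ∈ O, w x ω * (min (f (F x ω)) M - min (f x) M))
    (g := fun x => (π x).toReal * ∑ ω ∈ O, w x ω * (f (F x ω) - f x)) hG
    (fun x => by
      have hmin : ∀ y, Tendsto (fun M : ℕ => min (f y) (M : ℝ)) atTop (𝓝 (f y)) := by
        intro y
        refine tendsto_const_nhds.congr' ?_
        filter_upwards [eventually_ge_atTop ⌈f y⌉₊] with M hM
        rw [min_eq_left ((Nat.le_ceil _).trans (by exact_mod_cast hM))]
      exact (tendsto_finsetSum _ fun ω _ =>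
        (((hmin _).sub (hmin _)).const_mul _)).const_mul _)
    (Eventually.of_forall fun M x => by
      rw [norm_mul, Real.norm_eq_abs, Real.norm_eq_abs, abs_of_nonneg ENNReal.toReal_nonneg]
      refine mul_le_mul_of_nonneg_left (h.abs_sum_le x fun ω hω => ?_) ENNReal.toReal_nonneg
      exact (abs_min_sub_min_le_max _ _ _ _).trans
        (by simpa using hinc x ω hω))
  simp only [hzero] at hlim
  rw [hs.hasSum_iff]
  exact (tendsto_nhds_unique tendsto_const_nhds hlim).symm

/-- The second moment identity for a queue `ℓ⁺ = ℓ + X + u` with mean drift `E X = -ε`, where the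
cross term `u ℓ⁺` is controlled by a function `H` of the current state. -/
theorem abs_mean_sub_le (h : FiniteRep K O w F) {π : PMF α} (hπ : IsStationary K π)
    {ℓ H : α → ℝ} {X : Ω → ℝ} {u : α → Ω → ℝ} {C ε m₂ B η : ℝ}
    (hℓ : ∀ x, 0 ≤ ℓ x) (hη : 0 < η)
    (hstep : ∀ x, ∀ ω ∈ O, ℓ (F x ω) = ℓ x + X ω + u x ω)
    (hX : ∀ ω ∈ O, |X ω| ≤ C) (hu0 : ∀ x, ∀ ω ∈ O, 0 ≤ u x ω) (huC : ∀ x, ∀ ω ∈ O, u x ω ≤ C)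
    (hX1 : ∀ x, ∑ ω ∈ O, w x ω * X ω = -ε) (hX2 : ∀ x, ∑ ω ∈ O, w x ω * X ω ^ 2 = m₂)
    (huH : ∀ x, ∀ ω ∈ O, u x ω * ℓ (F x ω) ≤ u x ω * H x)
    (hℓs : Summable fun x => (π x).toReal * ℓ x)
    (hHs : Summable fun x => (π x).toReal * H x ^ 2)
    (hHB : ∑' x, (π x).toReal * H x ^ 2 ≤ B) :
    |2 * ε * ∑' x, (π x).toReal * ℓ x - m₂| ≤ η * B + (C / η + C) * ε := by
  have h1 := hasSum_toReal π
  -- Zero drift of `ℓ`: the mean unused service equals `ε`.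
  have hub : HasSum (fun x => (π x).toReal * ∑ ω ∈ O, w x ω * u x ω) ε := by
    have h2 := h.hasSum_drift hπ (f := ℓ) (G := fun _ => 2 * C) hℓ (h1.summable.mul_right _)
      (fun x ω hω => by
        rw [hstep x ω hω, abs_le]
        have := abs_le.1 (hX ω hω)
        constructor <;> linarith [hu0 x ω hω, huC x ω hω])
    have h3 : ∀ x, ∑ ω ∈ O, w x ω * (ℓ (F x ω) - ℓ x) = -ε + ∑ ω ∈ O, w x ω * u x ω := by
      intro x
      rw [← hX1 x, ← Finset.sum_add_distrib]
      exact Finset.sum_congr rfl fun ω hω => by rw [hstep x ω hω]; ring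
    have h4 := h2.add (h1.mul_right ε)
    simp only [h3] at h4
    convert h4 using 1
    · funext x; ring
    · ring
  -- Zero drift of `ℓ²`, from `(ℓ⁺)² = (ℓ + X)² + 2 u ℓ⁺ - u²`. The increments grow linearly in `ℓ`,
  -- so a first moment of `ℓ` is enough.
  have hr : HasSum (fun x => (π x).toReal *
      ∑ ω ∈ O, w x ω * (2 * (u x ω * ℓ (F x ω)) - u x ω ^ 2))
      (2 * ε * ∑' x, (π x).toReal * ℓ x - m₂) := by
    have h2 := h.hasSum_drift hπ (f := fun x => ℓ x ^ 2)
      (G := fun x => 4 * C * ℓ x + 4 * C ^ 2) (fun x => sq_nonneg _)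
      (by
        refine ((hℓs.mul_left (4 * C)).add (h1.summable.mul_right (4 * C ^ 2))).congr fun x => ?_
        ring)
      (fun x ω hω => by
        have hX' := abs_le.1 (hX ω hω)
        have hC0 : 0 ≤ C := (abs_nonneg _).trans (hX ω hω)
        have hd : |ℓ (F x ω) - ℓ x| ≤ 2 * C := by
          rw [hstep x ω hω, abs_le]
          constructor <;> linarith [hu0 x ω hω, huC x ω hω]
        have hs : |ℓ (F x ω) + ℓ x| ≤ 2 * ℓ x + 2 * C := by
          have := abs_le.1 hd
          rw [abs_of_nonneg (add_nonneg (hℓ _) (hℓ _))]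
          linarith
        calc |ℓ (F x ω) ^ 2 - ℓ x ^ 2| = |ℓ (F x ω) - ℓ x| * |ℓ (F x ω) + ℓ x| := by
              rw [← abs_mul]; ring_nf
          _ ≤ (2 * C) * (2 * ℓ x + 2 * C) := by gcongr
          _ = _ := by ring)
    have h3 : ∀ x, ∑ ω ∈ O, w x ω * (ℓ (F x ω) ^ 2 - ℓ x ^ 2) = -(2 * ε * ℓ x) + m₂
        + ∑ ω ∈ O, w x ω * (2 * (u x ω * ℓ (F x ω)) - u x ω ^ 2) := by
      intro x
      have : -(2 * ε * ℓ x) = ∑ ω ∈ O, w x ω * X ω * (2 * ℓ x) := by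
        rw [← Finset.sum_mul, hX1 x]; ring
      rw [this, ← hX2 x, ← Finset.sum_add_distrib, ← Finset.sum_add_distrib]
      exact Finset.sum_congr rfl fun ω hω => by rw [hstep x ω hω]; ring
    have h4 := (h2.add (hℓs.hasSum.mul_left (2 * ε))).add (h1.mul_right (-m₂))
    simp only [h3] at h4
    convert h4 using 1
    · funext x; ring
    · ring
  have hC0 : 0 ≤ C := by
    obtain ⟨x, -⟩ := π.support_nonempty
    have hO : O.Nonempty := by
      by_contra hO
      simpa [Finset.not_nonempty_iff_eq_empty.1 hO] using h.sum_one x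
    exact (abs_nonneg _).trans (hX _ hO.choose_spec)
  have hε : 0 ≤ ε := hub.nonneg fun x => mul_nonneg ENNReal.toReal_nonneg
    (Finset.sum_nonneg fun ω hω => mul_nonneg (h.nonneg x ω hω) (hu0 x ω hω))
  have hu2 : ∀ x, ∀ ω ∈ O, u x ω ^ 2 ≤ C * u x ω := fun x ω hω => by
    nlinarith [hu0 x ω hω, huC x ω hω]
  rw [abs_le]
  constructor
  · have h5 : -(C * ε) ≤ 2 * ε * ∑' x, (π x).toReal * ℓ x - m₂ := by
      refine hasSum_le (fun x => ?_) (hub.mul_left C).neg hr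
      rw [← neg_mul, mul_left_comm]
      refine mul_le_mul_of_nonneg_left ?_ ENNReal.toReal_nonneg
      rw [Finset.mul_sum]
      refine Finset.sum_le_sum fun ω hω => ?_
      rw [mul_left_comm]
      refine mul_le_mul_of_nonneg_left ?_ (h.nonneg x ω hω)
      nlinarith [hu2 x ω hω, mul_nonneg (hu0 x ω hω) (hℓ (F x ω))]
    have hB : 0 ≤ B := le_trans (tsum_nonneg fun x => mul_nonneg ENNReal.toReal_nonneg
      (sq_nonneg _)) hHB
    have : 0 ≤ C / η * ε := by positivity
    nlinarith [mul_nonneg hη.le hB]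
  · have h5 : 2 * ε * ∑' x, (π x).toReal * ℓ x - m₂
        ≤ η * ∑' x, (π x).toReal * H x ^ 2 + C / η * ε := by
      refine hasSum_le (fun x => ?_) hr ((hHs.hasSum.mul_left η).add (hub.mul_left (C / η)))
      have : η * ((π x).toReal * H x ^ 2) + C / η * ((π x).toReal * ∑ ω ∈ O, w x ω * u x ω)
          = (π x).toReal * ∑ ω ∈ O, w x ω * (η * H x ^ 2 + C / η * u x ω) := by
        simp only [mul_add, Finset.sum_add_distrib, h.sum_const, Finset.mul_sum]
        congr 1
        · ring
        · exact Finset.sum_congr rfl fun ω _ => by ring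
      rw [this]
      refine mul_le_mul_of_nonneg_left (h.sum_mono x fun ω hω => ?_) ENNReal.toReal_nonneg
      -- Weighted AM–GM. The `u²` part is at most `C u / η`, of mean `C ε / η`; the free parameter
      -- `η` later becomes `√ε`.
      have h6 : 2 * (u x ω * H x) ≤ η * H x ^ 2 + u x ω ^ 2 / η := by
        have h7 : 0 ≤ (η * H x - u x ω) ^ 2 / η := by positivity
        have h8 : (η * H x - u x ω) ^ 2 / η = η * H x ^ 2 - 2 * (u x ω * H x) + u x ω ^ 2 / η := by
          field_simp
          ring
        linarith
      have h9 : u x ω ^ 2 / η ≤ C / η * u x ω := by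
        rw [div_mul_eq_mul_div]
        exact div_le_div_of_nonneg_right (hu2 x ω hω) hη.le
      nlinarith [huH x ω hω, sq_nonneg (u x ω)]
    nlinarith [mul_nonneg hC0 hε, mul_le_mul_of_nonneg_left hHB hη.le]

end FiniteRep

/-! ### The dispatching distribution of power-of-`d` -/

/-- In the order of servers given by `σ`, position `i` is the first one whose server lies in `D`. -/
def IsFirst {N : ℕ} (σ : Equiv.Perm (Fin N)) (D : Finset (Fin N)) (i : Fin N) : Prop :=
  σ i ∈ D ∧ ∀ j < i, σ j ∉ D

theorem exists_isFirst {N : ℕ} (σ : Equiv.Perm (Fin N)) {D : Finset (Fin N)} (hD : D.Nonempty) :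
    ∃ i, IsFirst σ D i := by
  obtain ⟨n, hn⟩ := hD
  obtain ⟨i, hi, hmin⟩ := (Finset.univ.filter fun i => σ i ∈ D).exists_min_image id
    ⟨σ.symm n, by simpa using hn⟩
  exact ⟨i, by simpa using hi, fun j hj hjD => (hmin j (by simpa using hjD)).not_gt hj⟩

theorem IsFirst.unique {N : ℕ} {σ : Equiv.Perm (Fin N)} {D : Finset (Fin N)} {i j : Fin N}
    (hi : IsFirst σ D i) (hj : IsFirst σ D j) : i = j := by
  rcases lt_trichotomy i j with h | h | h
  · exact absurd hi.1 (hj.2 i h)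
  · exact h
  · exact absurd hj.1 (hi.2 j h)

-- Removing `σ i` is a bijection onto the `(d - 1)`-subsets of the servers at positions after `i`.
open Classical in
theorem card_isFirst {N d : ℕ} (hd : 1 ≤ d) (σ : Equiv.Perm (Fin N)) (i : Fin N) :
    ((Finset.univ.powersetCard d).filter fun D => IsFirst σ D i).card
      = (N - ((i : ℕ) + 1)).choose (d - 1) := by
  have hmem : ∀ n, n ∈ (Finset.Ioi i).map σ.toEmbedding ↔ i < σ.symm n := by
    intro n
    simp only [Finset.mem_map_equiv, Finset.mem_Ioi]
  have h1 : ((Finset.Ioi i).map σ.toEmbedding).card = N - ((i : ℕ) + 1) := by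
    rw [Finset.card_map, Fin.card_Ioi]; omega
  rw [← h1, ← Finset.card_powersetCard]
  refine Finset.card_nbij' (fun D => D.erase (σ i)) (fun E => insert (σ i) E) ?_ ?_ ?_ ?_
  · intro D hD
    simp only [Finset.coe_filter, Finset.mem_powersetCard, Set.mem_ofPred_eq] at hD
    simp only [Finset.mem_coe, Finset.mem_powersetCard]
    refine ⟨fun n hn => ?_, ?_⟩
    · rw [hmem]
      obtain ⟨hne, hnD⟩ := Finset.mem_erase.1 hn
      rcases lt_trichotomy i (σ.symm n) with h | h | h
      · exact h
      · exact absurd (by rw [h]; simp) hne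
      · exact absurd (by simpa using hnD) (hD.2.2 _ h)
    · rw [Finset.card_erase_of_mem hD.2.1, hD.1.2]
  · intro E hE
    simp only [Finset.mem_coe, Finset.mem_powersetCard] at hE
    simp only [Finset.coe_filter, Finset.mem_powersetCard, Set.mem_ofPred_eq]
    have hi : σ i ∉ E := fun h => by simpa using (hmem _).1 (hE.1 h)
    refine ⟨⟨Finset.subset_univ _, ?_⟩, Finset.mem_insert_self _ _, fun j hj hjE => ?_⟩
    · rw [Finset.card_insert_of_notMem hi, hE.2]; omega
    · rcases Finset.mem_insert.1 hjE with h | h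
      · exact hj.ne (σ.injective h)
      · have := (hmem _).1 (hE.1 h)
        rw [Equiv.symm_apply_apply] at this
        exact this.not_gt hj
  · intro D hD
    simp only [Finset.coe_filter, Set.mem_ofPred_eq] at hD
    exact Finset.insert_erase hD.2.1
  · intro E hE
    simp only [Finset.mem_coe, Finset.mem_powersetCard] at hE
    exact Finset.erase_insert fun h => by simpa using (hmem _).1 (hE.1 h)

/-- Summation over all samples, according to the first sampled position. -/
theorem sum_samples {N d : ℕ} (hd : 1 ≤ d) (σ : Equiv.Perm (Fin N)) (φ : Finset (Fin N) → ℝ)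
    (f : Fin N → ℝ) (h : ∀ D i, IsFirst σ D i → φ D = f i) :
    ∑ D ∈ Finset.univ.powersetCard d, φ D
      = ∑ i : Fin N, ((N - ((i : ℕ) + 1)).choose (d - 1) : ℝ) * f i := by
  classical
  have h1 : ∀ D ∈ (Finset.univ : Finset (Fin N)).powersetCard d,
      φ D = ∑ i, if IsFirst σ D i then f i else 0 := by
    intro D hD
    have hDc := (Finset.mem_powersetCard.1 hD).2
    obtain ⟨i, hi⟩ := exists_isFirst σ (Finset.card_pos.1 (by omega : 0 < D.card))
    rw [Finset.sum_eq_single i, if_pos hi, h D i hi]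
    · intro j _ hj
      exact if_neg fun hj' => hj (hj'.unique hi)
    · simp
  rw [Finset.sum_congr rfl h1, Finset.sum_comm]
  refine Finset.sum_congr rfl fun i _ => ?_
  rw [← card_isFirst hd σ i, ← Finset.sum_filter, Finset.sum_const, nsmul_eq_mul]

theorem sum_powerOfDProb_mul {N d : ℕ} (hd : 1 ≤ d) (σ : Equiv.Perm (Fin N))
    (φ : Finset (Fin N) → ℝ) (f : Fin N → ℝ) (h : ∀ D i, IsFirst σ D i → φ D = f i) :
    ∑ i, powerOfDProb N d i * f i
      = (∑ D ∈ Finset.univ.powersetCard d, φ D) / (N.choose d : ℝ) := by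
  rw [sum_samples hd σ φ f h, Finset.sum_div]
  exact Finset.sum_congr rfl fun i _ => by rw [powerOfDProb]; ring

theorem sum_powerOfDProb {N d : ℕ} (hd : 1 ≤ d) (hdN : d ≤ N) :
    ∑ i, powerOfDProb N d i = 1 := by
  have h := sum_powerOfDProb_mul hd (Equiv.refl (Fin N)) (fun _ => 1) (fun _ => 1)
    fun _ _ _ => rfl
  have hc : (N.choose d : ℝ) ≠ 0 := by exact_mod_cast (Nat.choose_pos hdN).ne'
  simpa [hc] using h

theorem powerOfDProb_nonneg (N d : ℕ) (i : Fin N) : 0 ≤ powerOfDProb N d i := by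
  unfold powerOfDProb; positivity

theorem sum_uniform_mul {N : ℕ} {s : Finset (Fin N)} (hs : s.Nonempty) {G : Fin N → ℝ} {c : ℝ}
    (h : ∀ n ∈ s, G n = c) : ∑ n, (PMF.uniformOfFinset s hs n).toReal * G n = c := by
  have h1 : ∀ n, (PMF.uniformOfFinset s hs n).toReal * G n
      = (PMF.uniformOfFinset s hs n).toReal * c := by
    intro n
    by_cases hn : n ∈ s
    · rw [h n hn]
    · rw [PMF.uniformOfFinset_apply_of_notMem hs hn]; simp
  rw [Finset.sum_congr rfl fun n _ => h1 n, ← Finset.sum_mul,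
    ← ENNReal.toReal_sum fun n _ => PMF.apply_ne_top _ n, ← tsum_fintype (L := .unconditional _),
    PMF.tsum_coe, ENNReal.toReal_one, one_mul]

/-- Because `G` is constant on the shortest queues of each sample, the tie-breaking rule drops out
and only the average over samples remains. -/
theorem sum_dispatch_mul {N d : ℕ} (hd : 2 ≤ d) (hdN : d ≤ N) (z : State N) (G : Fin N → ℝ)
    (c : Finset (Fin N) → ℝ)
    (h : ∀ D : Finset (Fin N), D.card = d → ∀ n ∈ shortestIn z.1 D, G n = c D) :
    ∑ n, ((powerOfD N d hd hdN).dispatch z n).toReal * G n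
      = (∑ D ∈ Finset.univ.powersetCard d, c D) / (N.choose d : ℝ) := by
  have : Nonempty (Sample N d) := sample_nonempty hdN
  have hne : ∀ D : Sample N d, D.1.Nonempty := fun D =>
    Finset.card_pos.1 (by have := D.2; omega)
  have h1 : ∀ n, ((powerOfD N d hd hdN).dispatch z n).toReal
      = ∑ D : Sample N d, (N.choose d : ℝ)⁻¹ *
        (PMF.uniformOfFinset (shortestIn z.1 D.1) (shortestIn_nonempty z.1 (hne D)) n).toReal := by
    intro n
    simp only [powerOfD, PMF.bind_apply]
    rw [tsum_fintype, ENNReal.toReal_sum fun D _ =>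
      ENNReal.mul_ne_top (PMF.apply_ne_top _ _) (PMF.apply_ne_top _ _)]
    refine Finset.sum_congr rfl fun D _ => ?_
    rw [ENNReal.toReal_mul, PMF.uniformOfFintype_apply, ENNReal.toReal_inv, ENNReal.toReal_natCast,
      Fintype.card_finset_len, Fintype.card_fin]
  simp only [h1, Finset.sum_mul]
  rw [Finset.sum_comm]
  simp only [mul_assoc, ← Finset.mul_sum]
  rw [div_eq_inv_mul]
  congr 1
  rw [Finset.sum_congr rfl fun D _ => sum_uniform_mul _ (h D.1 D.2)]
  exact (Finset.sum_subtype _ (fun D => by simp [Finset.mem_powersetCard]) c).symm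

theorem IsSorting.first_mem {N : ℕ} {q : Queues N} {σ : Equiv.Perm (Fin N)} (hσ : IsSorting q σ)
    {D : Finset (Fin N)} {i : Fin N} (hi : IsFirst σ D i) : σ i ∈ shortestIn q D := by
  refine Finset.mem_filter.2 ⟨hi.1, fun m hm => ?_⟩
  have : i ≤ σ.symm m := not_lt.1 fun h => hi.2 _ h (by simpa using hm)
  simpa using hσ this

theorem eq_of_mem_shortestIn {N : ℕ} {q : Queues N} {D : Finset (Fin N)} {m n : Fin N}
    (hm : m ∈ shortestIn q D) (hn : n ∈ shortestIn q D) : q m = q n := by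
  obtain ⟨hm1, hm2⟩ := Finset.mem_filter.1 hm
  obtain ⟨hn1, hn2⟩ := Finset.mem_filter.1 hn
  exact le_antisymm (hm2 n hn1) (hn2 m hm1)

/-- The mean length of the queue that receives the arrivals. -/
theorem sum_sortedDispatch_mul {N d : ℕ} (hd : 2 ≤ d) (hdN : d ≤ N) (z : State N)
    {σ : Equiv.Perm (Fin N)} (hσ : IsSorting z.1 σ) (G : Fin N → ℝ)
    (hG : ∀ D : Finset (Fin N), ∀ m ∈ shortestIn z.1 D, ∀ n ∈ shortestIn z.1 D, G m = G n) :
    ∑ i, sortedDispatch (powerOfD N d hd hdN) z σ i * G (σ i)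
      = ∑ i, powerOfDProb N d i * G (σ i) := by
  classical
  -- The common value of `G` on the shortest queues of `D`. The default `0` concerns only `D = ∅`,
  -- which is never a sample.
  set c : Finset (Fin N) → ℝ := fun D =>
    if h : (shortestIn z.1 D).Nonempty then G h.choose else 0 with hc
  have hcD : ∀ D, ∀ n ∈ shortestIn z.1 D, G n = c D := by
    intro D n hn
    have h : (shortestIn z.1 D).Nonempty := ⟨n, hn⟩
    simp only [hc, dif_pos h]
    exact hG D n hn _ h.choose_spec
  rw [sum_powerOfDProb_mul (by omega) σ c (fun i => G (σ i)) fun D i hi =>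
    (hcD D _ (hσ.first_mem hi)).symm, ← sum_dispatch_mul hd hdN z G c fun D _ => hcD D]
  exact Equiv.sum_comp σ fun n => ((powerOfD N d hd hdN).dispatch z n).toReal * G n

/-- Without ties the shortest queue of a sample is unique, so even the indicator of a single server
is constant on it. -/
theorem sortedDispatch_powerOfD {N d : ℕ} (hd : 2 ≤ d) (hdN : d ≤ N) (z : State N)
    (hz : Function.Injective z.1) {σ : Equiv.Perm (Fin N)} (hσ : IsSorting z.1 σ) :
    sortedDispatch (powerOfD N d hd hdN) z σ = powerOfDProb N d := by
  funext i
  have h := sum_sortedDispatch_mul hd hdN z hσ (fun n => if n = σ i then 1 else 0)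
    fun D m hm n hn => by rw [hz (eq_of_mem_shortestIn hm hn)]
  simpa using h

theorem innerEquiv_powerOfD {N d : ℕ} (hd : 2 ≤ d) (hdN : d ≤ N) (z : State N)
    {σ : Equiv.Perm (Fin N)} (hσ : IsSorting z.1 σ) :
    InnerEquiv z.1 σ (sortedDispatch (powerOfD N d hd hdN) z σ) (powerOfDProb N d) := by
  refine ⟨⟨powerOfDProb_nonneg N d, sum_powerOfDProb (by omega) hdN⟩, ?_⟩
  have h := sum_sortedDispatch_mul hd hdN z hσ (fun n => (z.1 n : ℝ))
    fun D m hm n hn => by rw [eq_of_mem_shortestIn hm hn]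
  simpa only [mul_comm] using h

/-! ### Tilt of the power-of-`d` vector and membership in `Π` -/

theorem Delta_const {N : ℕ} (hN : 0 < N) {μ : ℝ} (hμ : 0 < μ) (σ : Equiv.Perm (Fin N))
    (p : Fin N → ℝ) (i : Fin N) : Delta (fun _ => μ) σ p i = p i - 1 / N := by
  have : (N : ℝ) ≠ 0 := by exact_mod_cast hN.ne'
  simp only [Delta, Finset.sum_const, Finset.card_univ, Fintype.card_fin, nsmul_eq_mul]
  field_simp

theorem powerOfDProb_antitone (N d : ℕ) : Antitone (powerOfDProb N d) := by
  intro i j hij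
  unfold powerOfDProb
  gcongr
  exact hij

theorem deltaTilted_powerOfD {N d : ℕ} (hd : 2 ≤ d) (hdN : d ≤ N) {μ : ℝ} (hμ : 0 < μ)
    (σ : Equiv.Perm (Fin N)) :
    DeltaTilted (1 / (N : ℝ)) (fun _ => μ) σ (powerOfDProb N d) := by
  have hN : 0 < N := by omega
  have hNr : (0 : ℝ) < N := by exact_mod_cast hN
  have hfirst : ∀ i : Fin N, (i : ℕ) + 1 = 1 → 2 / (N : ℝ) ≤ powerOfDProb N d i := by
    intro i hi
    have hc : (0 : ℝ) < N.choose d := by exact_mod_cast Nat.choose_pos hdN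
    -- The absorption identity shows that the first entry is `d / N`.
    have h1 : N * (N - 1).choose (d - 1) = N.choose d * d := by
      have := Nat.add_one_mul_choose_eq (N - 1) (d - 1)
      rwa [Nat.sub_add_cancel hN, Nat.sub_add_cancel (by omega : 1 ≤ d)] at this
    have h1' : (N : ℝ) * ((N - 1).choose (d - 1) : ℕ) = N.choose d * d := by exact_mod_cast h1
    rw [powerOfDProb, hi, div_le_div_iff₀ hNr hc]
    have : (2 : ℝ) ≤ d := by exact_mod_cast hd
    nlinarith
  have hlast : ∀ i : Fin N, (i : ℕ) + 1 = N → powerOfDProb N d i = 0 := by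
    intro i hi
    rw [powerOfDProb, hi, Nat.sub_self, Nat.choose_eq_zero_of_lt (by omega)]
    simp
  simp only [DeltaTilted, Tilted, Delta_const hN hμ]
  refine ⟨by positivity, ?_, fun i hi => ?_, fun i hi => ?_⟩
  · classical
    -- `k` is the length of the longest initial segment with entries at least `1 / N`, capped at `N
    -- - 1` so that the tilting index `k + 1` does not exceed `N`.
    set k := Nat.findGreatest (fun k => ∀ i : Fin N, (i : ℕ) + 1 ≤ k →
      1 / (N : ℝ) ≤ powerOfDProb N d i) (N - 1) with hk
    have hk1 : 1 ≤ k := by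
      refine Nat.le_findGreatest (by omega) fun i hi => ?_
      refine le_trans ?_ (hfirst i (by omega))
      gcongr
      norm_num
    have hkN : k ≤ N - 1 := Nat.findGreatest_le _
    have hspec : ∀ i : Fin N, (i : ℕ) + 1 ≤ k → 1 / (N : ℝ) ≤ powerOfDProb N d i :=
      Nat.findGreatest_spec (P := fun k => ∀ i : Fin N, (i : ℕ) + 1 ≤ k →
        1 / (N : ℝ) ≤ powerOfDProb N d i) (m := 0) (Nat.zero_le _) (fun i hi => by omega)
    refine ⟨k + 1, by omega, by omega, fun i hi => sub_nonneg.2 (hspec i (by omega)),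
      fun i hi => ?_⟩
    rw [sub_nonpos]
    by_contra! hlt
    -- Below the cap, an entry above `1 / N` past position `k` would by monotonicity extend the
    -- segment. At the cap, the only remaining entry is the last one, which is zero.
    rcases Nat.lt_or_ge k (N - 1) with h | h
    · refine Nat.findGreatest_is_greatest (n := N - 1) (Nat.lt_succ_self k) h fun j hj => ?_
      exact hlt.le.trans (powerOfDProb_antitone N d (by rw [Fin.le_def]; omega))
    · rw [hlast i (by omega)] at hlt
      have : (0 : ℝ) < 1 / N := by positivity
      linarith
  · have := hfirst i hi
    rw [le_sub_iff_add_le]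
    exact le_trans (le_of_eq (by ring)) this
  · rw [hlast i hi]; simp

theorem inPi_powerOfD {N d : ℕ} (hd : 2 ≤ d) (hdN : d ≤ N) {μ : ℝ} (hμ : 0 < μ) :
    InPi (powerOfD N d hd hdN) (fun _ => μ) := by
  refine ⟨fun _ _ _ _ _ _ _ _ _ _ z _ σ hσ => ⟨_, innerEquiv_powerOfD hd hdN z hσ,
    (deltaTilted_powerOfD hd hdN hμ σ).2.1⟩, 1, one_pos, 1 / N, ?_, ?_⟩
  · exact (deltaTilted_powerOfD hd hdN hμ (Equiv.refl _)).1
  -- With `T = 1` each block is the single slot `k`.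
  · exact fun _ _ _ _ _ _ _ _ _ k => ⟨k, by omega, by omega, fun z _ σ hσ =>
      ⟨_, innerEquiv_powerOfD hd hdN z hσ, deltaTilted_powerOfD hd hdN hμ σ⟩⟩

/-! ### Arrivals and services in one slot -/

theorem sum_toReal_of_support {α : Type*} (p : PMF α) (T : Finset α) (hT : ∀ x ∈ p.support, x ∈ T) :
    ∑ x ∈ T, (p x).toReal = 1 := by
  have h := p.tsum_coe
  rw [tsum_eq_sum fun x hx => (p.apply_eq_zero_iff x).2 fun h => hx (hT x h)] at h
  rw [← ENNReal.toReal_sum fun x _ => p.apply_ne_top x, h, ENNReal.toReal_one]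

section Support

variable {α : Type*} [MeasurableSpace α] [Countable α] [MeasurableSingletonClass α]

theorem integral_eq_sum_of_support (p : PMF α) (T : Finset α) (hT : ∀ x ∈ p.support, x ∈ T)
    (f : α → ℝ) : ∫ x, f x ∂p.toMeasure = ∑ x ∈ T, (p x).toReal * f x := by
  have hint : Integrable f p.toMeasure := by
    refine Integrable.of_bound (Measurable.of_discrete.aestronglyMeasurable) (∑ x ∈ T, |f x|) ?_
    rw [ae_iff, PMF.toMeasure_apply_eq_zero_iff _ (Set.to_countable _).measurableSet,
      Set.disjoint_left]
    exact fun x hx h => h (Finset.single_le_sum (f := fun x => |f x|)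
      (fun _ _ => abs_nonneg _) (hT x hx))
  rw [PMF.integral_eq_tsum p f hint]
  refine tsum_eq_sum fun x hx => ?_
  rw [(p.apply_eq_zero_iff x).2 fun h => hx (hT x h), ENNReal.toReal_zero, zero_smul]

end Support

section Slots

variable {N : ℕ}

/-- The possible numbers of arrivals and offered services in a slot. -/
def slots (N Amax Smax : ℕ) : Finset (ℕ × (Fin N → ℕ)) :=
  Finset.range (Amax + 1) ×ˢ Fintype.piFinset fun _ => Finset.range (Smax + 1)

/-- The probability of given arrivals and services. -/
def slotProb (A : PMF ℕ) (S : PMF (Fin N → ℕ)) (ν : ℕ × (Fin N → ℕ)) : ℝ :=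
  (A ν.1).toReal * (S ν.2).toReal

/-- Arrivals minus total offered service. -/
def netInput (ν : ℕ × (Fin N → ℕ)) : ℝ := (ν.1 : ℝ) - ∑ n, (ν.2 n : ℝ)

theorem slotProb_nonneg (A : PMF ℕ) (S : PMF (Fin N → ℕ)) (ν : ℕ × (Fin N → ℕ)) :
    0 ≤ slotProb A S ν := mul_nonneg ENNReal.toReal_nonneg ENNReal.toReal_nonneg

theorem mem_slots {Amax Smax : ℕ} {ν : ℕ × (Fin N → ℕ)} :
    ν ∈ slots N Amax Smax ↔ ν.1 ≤ Amax ∧ ∀ n, ν.2 n ≤ Smax := by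
  simp [slots, Finset.mem_product]

/-! ### First and second moments of the net input -/

section Moments

variable {A : PMF ℕ} {S : PMF (Fin N → ℕ)} {lam : ℝ} {Amax Smax : ℕ} {μ : Fin N → ℝ}

theorem IsArrivalLaw.mem_range (hA : IsArrivalLaw A lam Amax) :
    ∀ a ∈ A.support, a ∈ Finset.range (Amax + 1) := fun a ha => by
  have := hA.bounded a ha
  simp; omega

theorem IsServiceLaw.mem_piFinset (hS : IsServiceLaw S μ Smax) :
    ∀ s ∈ S.support, s ∈ Fintype.piFinset fun _ : Fin N => Finset.range (Smax + 1) :=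
  fun s hs => by
    have := hS.bounded s hs
    simpa [Nat.lt_succ_iff] using this

/-- Arrivals and services are independent, so expectations of products factor. -/
theorem sum_slots_mul (hA : IsArrivalLaw A lam Amax) (hS : IsServiceLaw S μ Smax)
    (f : ℕ → ℝ) (g : (Fin N → ℕ) → ℝ) :
    ∑ ν ∈ slots N Amax Smax, slotProb A S ν * (f ν.1 * g ν.2)
      = (∫ a, f a ∂A.toMeasure) * ∫ s, g s ∂S.toMeasure := by
  rw [integral_eq_sum_of_support A _ hA.mem_range, integral_eq_sum_of_support S _ hS.mem_piFinset,
    Finset.sum_mul_sum, slots, Finset.sum_product]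
  exact Finset.sum_congr rfl fun a _ => Finset.sum_congr rfl fun s _ => by
    simp only [slotProb]; ring

theorem sum_slotProb (hA : IsArrivalLaw A lam Amax) (hS : IsServiceLaw S μ Smax) :
    ∑ ν ∈ slots N Amax Smax, slotProb A S ν = 1 := by
  simpa using sum_slots_mul hA hS (fun _ => 1) fun _ => 1

theorem sum_slots_arrivals (hA : IsArrivalLaw A lam Amax) (hS : IsServiceLaw S μ Smax) :
    ∑ ν ∈ slots N Amax Smax, slotProb A S ν * (ν.1 : ℝ) = lam := by
  simpa [hA.mean] using sum_slots_mul hA hS (fun a => (a : ℝ)) fun _ => 1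

theorem sum_slots_service (hA : IsArrivalLaw A lam Amax) (hS : IsServiceLaw S μ Smax)
    (n : Fin N) : ∑ ν ∈ slots N Amax Smax, slotProb A S ν * (ν.2 n : ℝ) = μ n := by
  simpa [hS.mean] using sum_slots_mul hA hS (fun _ => 1) fun s => (s n : ℝ)

theorem IsArrivalLaw.nonneg (hA : IsArrivalLaw A lam Amax) : 0 ≤ lam := by
  rw [← hA.mean]
  exact integral_nonneg fun a => Nat.cast_nonneg a

theorem sum_slots_linear (hA : IsArrivalLaw A lam Amax) (hS : IsServiceLaw S μ Smax)
    (k : ℝ) (c : Fin N → ℝ) :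
    ∑ ν ∈ slots N Amax Smax, slotProb A S ν * (ν.1 * k - ∑ n, c n * (ν.2 n : ℝ))
      = lam * k - ∑ n, c n * μ n := by
  simp only [mul_sub, Finset.sum_sub_distrib, Finset.mul_sum]
  congr 1
  · rw [← sum_slots_arrivals hA hS, Finset.sum_mul]
    exact Finset.sum_congr rfl fun ν _ => by ring
  · rw [Finset.sum_comm]
    refine Finset.sum_congr rfl fun n _ => ?_
    rw [← sum_slots_service hA hS n, Finset.mul_sum]
    exact Finset.sum_congr rfl fun ν _ => by ring

theorem sum_slots_netInput (hA : IsArrivalLaw A lam Amax) (hS : IsServiceLaw S μ Smax) :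
    ∑ ν ∈ slots N Amax Smax, slotProb A S ν * netInput ν = lam - ∑ n, μ n := by
  simpa [netInput] using sum_slots_linear hA hS 1 fun _ => 1

/-- The variance of the total offered service. -/
def serviceVar (S : PMF (Fin N → ℕ)) (μ : Fin N → ℝ) : ℝ :=
  ∫ s, (∑ n, μ n - ∑ n, (s n : ℝ)) ^ 2 ∂S.toMeasure

theorem sum_slots_netInput_sq (hA : IsArrivalLaw A lam Amax) (hS : IsServiceLaw S μ Smax) :
    ∑ ν ∈ slots N Amax Smax, slotProb A S ν * netInput ν ^ 2
      = variance (fun a : ℕ => (a : ℝ)) A.toMeasure + serviceVar S μ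
        + (∑ n, μ n - lam) ^ 2 := by
  have h1 := sum_slots_mul hA hS (fun a => ((a : ℝ) - lam) ^ 2) fun _ => 1
  have h2 := sum_slots_mul hA hS (fun _ => 1) fun s => (∑ n, μ n - ∑ n, (s n : ℝ)) ^ 2
  have h3 := sum_slots_mul hA hS (fun a => (a : ℝ) - lam) fun s => ∑ n, μ n - ∑ n, (s n : ℝ)
  have h4 := sum_slots_netInput hA hS
  have h5 := sum_slotProb hA hS
  have hz : ∫ a, ((a : ℝ) - lam) ∂A.toMeasure = 0 := by
    rw [integral_eq_sum_of_support A _ hA.mem_range]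
    simp only [mul_sub, Finset.sum_sub_distrib]
    rw [← integral_eq_sum_of_support A _ hA.mem_range fun a => (a : ℝ), hA.mean, ← Finset.sum_mul,
      sum_toReal_of_support A _ hA.mem_range]
    ring
  rw [hz, zero_mul] at h3
  rw [variance_eq_integral Measurable.of_discrete.aemeasurable, hA.mean]
  simp only [integral_const, probReal_univ, smul_eq_mul, mul_one, one_mul] at h1 h2
  rw [← h1, serviceVar, ← h2]
  set σ := ∑ n, μ n
  -- The net input is centred arrivals, plus centred services, plus the mean `lam - σ`. The cross
  -- term has mean zero by independence and centring.
  have h6 : ∀ ν : ℕ × (Fin N → ℕ), slotProb A S ν * netInput ν ^ 2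
      = slotProb A S ν * ((ν.1 : ℝ) - lam) ^ 2 + slotProb A S ν * (σ - ∑ n, (ν.2 n : ℝ)) ^ 2
        + 2 * (slotProb A S ν * (((ν.1 : ℝ) - lam) * (σ - ∑ n, (ν.2 n : ℝ))))
        + 2 * (lam - σ) * (slotProb A S ν * netInput ν) - (lam - σ) ^ 2 * slotProb A S ν := by
    intro ν
    simp only [netInput]
    ring
  rw [Finset.sum_congr rfl fun ν _ => h6 ν, Finset.sum_sub_distrib, Finset.sum_add_distrib,
    Finset.sum_add_distrib, Finset.sum_add_distrib, ← Finset.mul_sum, ← Finset.mul_sum,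
    ← Finset.mul_sum, h3, h4, h5]
  ring

end Moments

theorem abs_netInput_le {Amax Smax : ℕ} (hN : 0 < N) {ν : ℕ × (Fin N → ℕ)}
    (hν : ν ∈ slots N Amax Smax) : |netInput ν| ≤ N * ((Amax : ℝ) + Smax) := by
  obtain ⟨h1, h2⟩ := mem_slots.1 hν
  have h1' : (ν.1 : ℝ) ≤ Amax := by exact_mod_cast h1
  have h3 : ∑ n, (ν.2 n : ℝ) ≤ N * Smax := by
    calc _ ≤ ∑ _n : Fin N, (Smax : ℝ) := Finset.sum_le_sum fun n _ => by exact_mod_cast h2 n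
      _ = _ := by simp
  have h4 : 0 ≤ ∑ n, (ν.2 n : ℝ) := Finset.sum_nonneg fun _ _ => Nat.cast_nonneg _
  have h5 : (1 : ℝ) ≤ N := by exact_mod_cast hN
  have h6 : (Amax : ℝ) ≤ N * Amax := le_mul_of_one_le_left (Nat.cast_nonneg _) h5
  have h7 : (0 : ℝ) ≤ N * Smax := by positivity
  have h8 : (0 : ℝ) ≤ ν.1 := Nat.cast_nonneg _
  rw [netInput, abs_le]
  constructor <;> nlinarith

/-! ### The resource-pooled queue -/

section Pooled

variable {A : PMF ℕ} {S : PMF (Fin N → ℕ)} {lam : ℝ} {Amax Smax : ℕ} {μ : Fin N → ℝ}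

/-- One step of the resource-pooled queue. -/
def pooledMove (q : ℕ) (ν : ℕ × (Fin N → ℕ)) : ℕ := q + ν.1 - ∑ n, ν.2 n

theorem cast_pooledMove (q : ℕ) (ν : ℕ × (Fin N → ℕ)) :
    (pooledMove q ν : ℝ) = max (q + netInput ν) 0 := by
  rw [pooledMove, netInput]
  rcases le_total (∑ n, ν.2 n) (q + ν.1) with h | h
  · have h' : ((∑ n, ν.2 n : ℕ) : ℝ) ≤ ((q + ν.1 : ℕ) : ℝ) := by exact_mod_cast h
    rw [Nat.cast_sub h]
    push_cast at h' ⊢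
    rw [max_eq_left (by linarith)]
    ring
  · have h' : ((q + ν.1 : ℕ) : ℝ) ≤ ((∑ n, ν.2 n : ℕ) : ℝ) := by exact_mod_cast h
    rw [Nat.sub_eq_zero_of_le h]
    push_cast at h' ⊢
    rw [max_eq_right (by linarith)]

theorem pooled_finiteRep (hA : IsArrivalLaw A lam Amax) (hS : IsServiceLaw S μ Smax) :
    FiniteRep (pooledStep A S) (slots N Amax Smax) (fun _ => slotProb A S) pooledMove where
  nonneg _ ν _ := slotProb_nonneg A S ν
  sum_one _ := sum_slotProb hA hS
  ev_eq q f := by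
    rw [pooledStep, ev_bind, ev_eq_sum A _ hA.mem_range, slots, Finset.sum_product]
    refine Finset.sum_congr rfl fun a _ => ?_
    rw [ev_map, ev_eq_sum S _ hS.mem_piFinset, Finset.mul_sum]
    refine Finset.sum_congr rfl fun s _ => ?_
    rw [slotProb, ENNReal.ofReal_mul ENNReal.toReal_nonneg,
      ENNReal.ofReal_toReal (A.apply_ne_top a), ENNReal.ofReal_toReal (S.apply_ne_top s), mul_assoc]
    rfl

/-- Truncation at zero can only decrease the square, so the drift is at most that of the free walk.
-/
theorem pooled_drift_sq (hN : 0 < N) (hA : IsArrivalLaw A lam Amax) (hS : IsServiceLaw S μ Smax)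
    (q : ℕ) : ∑ ν ∈ slots N Amax Smax, slotProb A S ν * ((pooledMove q ν : ℝ) ^ 2 - (q : ℝ) ^ 2)
      ≤ (N * ((Amax : ℝ) + Smax)) ^ 2 - 2 * (∑ n, μ n - lam) * q := by
  have h := pooled_finiteRep hA hS
  calc _ ≤ ∑ ν ∈ slots N Amax Smax, slotProb A S ν *
        (netInput ν * (2 * q) + (N * ((Amax : ℝ) + Smax)) ^ 2) := by
        refine h.sum_mono q fun ν hν => ?_
        have h1 := abs_le.1 (abs_netInput_le hN hν)
        have h2 : (pooledMove q ν : ℝ) ^ 2 ≤ (q + netInput ν) ^ 2 := by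
          rw [cast_pooledMove, sq_le_sq, abs_of_nonneg (le_max_right _ _)]
          exact max_le (le_abs_self _) (abs_nonneg _)
        nlinarith
    _ = _ := by
      simp only [mul_add, Finset.sum_add_distrib, h.sum_const q, ← mul_assoc, ← Finset.sum_mul,
        sum_slots_netInput hA hS]
      ring

theorem pooled_exists_stationary (hN : 0 < N) (hA : IsArrivalLaw A lam Amax)
    (hS : IsServiceLaw S μ Smax) (hlt : lam < ∑ n, μ n) :
    ∃ ϖ, IsStationary (pooledStep A S) ϖ := by
  have hε : 0 < ∑ n, μ n - lam := sub_pos.2 hlt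
  refine (pooled_finiteRep hA hS).exists_stationary (f := fun q => (q : ℝ) ^ 2)
    (g := fun q => 2 * (∑ n, μ n - lam) * q) (fun q => sq_nonneg _) (fun q => by positivity)
    (sq_nonneg _) (pooled_drift_sq hN hA hS) 0 fun M => ?_
  refine (Set.finite_le_nat ⌊M / (2 * (∑ n, μ n - lam))⌋₊).subset fun q hq => ?_
  refine Nat.le_floor ?_
  rw [le_div_iff₀ (by positivity), mul_comm]
  exact hq

theorem pooled_summable (hN : 0 < N) (hA : IsArrivalLaw A lam Amax)
    (hS : IsServiceLaw S μ Smax) (hlt : lam < ∑ n, μ n) {ϖ : PMF ℕ}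
    (hϖ : IsStationary (pooledStep A S) ϖ) : Summable fun q => (ϖ q).toReal * (q : ℝ) := by
  have hε : 0 < ∑ n, μ n - lam := sub_pos.2 hlt
  have h := ((pooled_finiteRep hA hS).tsum_le hϖ (f := fun q => (q : ℝ) ^ 2)
    (g := fun q => 2 * (∑ n, μ n - lam) * q) (fun q => sq_nonneg _) (fun q => by positivity)
    (sq_nonneg _) (pooled_drift_sq hN hA hS)).1
  refine (h.mul_left (2 * (∑ n, μ n - lam))⁻¹).congr fun q => ?_
  field_simp

/-- A single queue that wastes service ends the slot empty, so the cross term vanishes and `H = 0`,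
`B = 0` are admissible. -/
theorem pooled_abs_mean_sub_le (hN : 0 < N) (hA : IsArrivalLaw A lam Amax)
    (hS : IsServiceLaw S μ Smax) (hlt : lam < ∑ n, μ n) {ϖ : PMF ℕ}
    (hϖ : IsStationary (pooledStep A S) ϖ) {η : ℝ} (hη : 0 < η) :
    |2 * (∑ n, μ n - lam) * ∑' q, (ϖ q).toReal * (q : ℝ)
        - (variance (fun a : ℕ => (a : ℝ)) A.toMeasure + serviceVar S μ + (∑ n, μ n - lam) ^ 2)|
      ≤ (N * ((Amax : ℝ) + Smax) / η + N * ((Amax : ℝ) + Smax)) * (∑ n, μ n - lam) := by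
  have h := (pooled_finiteRep hA hS).abs_mean_sub_le hϖ (ℓ := fun q => (q : ℝ)) (H := fun _ => 0)
    (X := netInput) (u := fun q ν => (pooledMove q ν : ℝ) - q - netInput ν)
    (C := N * ((Amax : ℝ) + Smax)) (ε := ∑ n, μ n - lam) (B := 0) (fun q => Nat.cast_nonneg q) hη
    (fun q ν _ => by ring) (fun ν hν => abs_netInput_le hN hν)
    (fun q ν _ => by
      rw [cast_pooledMove]; linarith [le_max_left ((q : ℝ) + netInput ν) 0])
    (fun q ν hν => by
      have h1 := abs_le.1 (abs_netInput_le hN hν)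
      have h2 : (0 : ℝ) ≤ q := Nat.cast_nonneg q
      have h3 : max ((q : ℝ) + netInput ν) 0 ≤ q + netInput ν + N * ((Amax : ℝ) + Smax) :=
        max_le (by linarith) (by linarith)
      rw [cast_pooledMove]; linarith)
    (fun _ => by rw [sum_slots_netInput hA hS]; ring) (fun _ => sum_slots_netInput_sq hA hS)
    (fun q ν _ => by
      rw [cast_pooledMove]
      rcases le_total ((q : ℝ) + netInput ν) 0 with h | h
      · rw [max_eq_right h]
      · rw [max_eq_left h]
        exact le_of_eq (by ring))
    (pooled_summable hN hA hS hlt hϖ) (by simp) (by simp)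
  simpa using h

end Pooled

end Slots

section Spread

variable {N : ℕ}

/-! ### The imbalance of the queue lengths -/

/-- Longest minus shortest queue length. -/
def spread (q : Queues N) : ℕ :=
  (Finset.univ : Finset (Fin N × Fin N)).sup fun p => q p.1 - q p.2

theorem abs_sub_le_spread (q : Queues N) (i j : Fin N) : |(q i : ℝ) - q j| ≤ spread q := by
  have h : ∀ i j : Fin N, q i - q j ≤ spread q := fun i j =>
    Finset.le_sup (f := fun p : Fin N × Fin N => q p.1 - q p.2) (Finset.mem_univ (i, j))
  have h1 := h i j
  have h2 := h j i
  have h3 : (q i : ℝ) ≤ spread q + q j := by exact_mod_cast (by omega)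
  have h4 : (q j : ℝ) ≤ spread q + q i := by exact_mod_cast (by omega)
  rw [abs_le]
  constructor <;> linarith

theorem exists_spread (hN : 0 < N) (q : Queues N) : ∃ i j, (spread q : ℝ) = (q i : ℝ) - q j := by
  have : Nonempty (Fin N) := ⟨⟨0, hN⟩⟩
  obtain ⟨⟨i, j⟩, -, h⟩ := (Finset.univ : Finset (Fin N × Fin N)).exists_mem_eq_sup
    Finset.univ_nonempty fun p => q p.1 - q p.2
  change spread q = q i - q j at h
  rcases le_total (q j) (q i) with hle | hle
  · exact ⟨i, j, by rw [h, Nat.cast_sub hle]⟩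
  · exact ⟨i, i, by rw [h, Nat.sub_eq_zero_of_le hle]; simp⟩

/-- Tilted dispatching pulls towards the short queues. -/
theorem DeltaTilted.sum_mul_Delta_le {q : Queues N} {σ : Equiv.Perm (Fin N)} {δ : ℝ}
    {μ p : Fin N → ℝ} (h : DeltaTilted δ μ σ p) (hσ : IsSorting q σ)
    (hsum : ∑ i, Delta μ σ p i = 0) (i j : Fin N) :
    ∑ m, (q (σ m) : ℝ) * Delta μ σ p m ≤ -(δ * ((q i : ℝ) - q j)) := by
  obtain ⟨hδ, ⟨k, hk2, hkN, hlt, hge⟩, hfirst, hlast⟩ := h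
  let a : Fin N := ⟨0, by omega⟩
  let b : Fin N := ⟨N - 1, by omega⟩
  -- The sorted position at which the sign of `Delta` changes, counted from zero.
  let κ : Fin N := ⟨k - 1, by omega⟩
  have hmono : ∀ {x y : Fin N}, x ≤ y → (q (σ x) : ℝ) ≤ q (σ y) := fun hxy => by
    exact_mod_cast hσ hxy
  have hi : (q i : ℝ) ≤ q (σ b) := by
    have := hmono (x := σ.symm i) (y := b) (by rw [Fin.le_def]; have := (σ.symm i).2; simp [b]; omega)
    simpa using this
  have hj : (q (σ a) : ℝ) ≤ q j := by
    have := hmono (x := a) (y := σ.symm j) (by rw [Fin.le_def]; simp [a])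
    simpa using this
  -- As `Delta` sums to zero, queue lengths may be measured from `q (σ κ)`. Every term is then
  -- nonpositive, and the two end terms together contribute at most `-δ` times the largest minus the
  -- smallest queue.
  have hterm : ∀ m, ((q (σ m) : ℝ) - q (σ κ)) * Delta μ σ p m
      ≤ (if m = a then -(δ * ((q (σ κ) : ℝ) - q (σ a))) else 0)
        + (if m = b then -(δ * ((q (σ b) : ℝ) - q (σ κ))) else 0) := by
    intro m
    have hab : a ≠ b := fun h => by
      have := congrArg Fin.val h
      simp only [a, b] at this
      omega
    by_cases hma : m = a
    · subst hma
      rw [if_pos rfl, if_neg hab]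
      have h1 := hfirst a (by simp [a])
      have h2 : (q (σ a) : ℝ) ≤ q (σ κ) := hmono (by rw [Fin.le_def]; simp [a])
      nlinarith
    by_cases hmb : m = b
    · subst hmb
      rw [if_neg hma, if_pos rfl]
      have h1 := hlast b (by simp only [b]; omega)
      have h2 : (q (σ κ) : ℝ) ≤ q (σ b) := hmono (by rw [Fin.le_def]; simp only [b, κ]; omega)
      nlinarith
    rw [if_neg hma, if_neg hmb, add_zero]
    rcases Nat.lt_or_ge ((m : ℕ) + 1) k with hm | hm
    · exact mul_nonpos_of_nonpos_of_nonneg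
        (sub_nonpos.2 (hmono (by rw [Fin.le_def]; simp only [κ]; omega))) (hlt m hm)
    · exact mul_nonpos_of_nonneg_of_nonpos
        (sub_nonneg.2 (hmono (by rw [Fin.le_def]; simp only [κ]; omega))) (hge m hm)
  have hs := Finset.sum_le_sum fun m (_ : m ∈ Finset.univ) => hterm m
  simp only [sub_mul, Finset.sum_sub_distrib, Finset.sum_add_distrib, Finset.sum_ite_eq',
    Finset.mem_univ, if_true, ← Finset.mul_sum, hsum] at hs
  nlinarith [mul_le_mul_of_nonneg_left (sub_le_sub hi hj) hδ.le]

/-- The imbalance functional `∑ i, ∑ j, (q i - q j)²`. -/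
def imbalance (q : Queues N) : ℝ := ∑ i, ∑ j, ((q i : ℝ) - q j) ^ 2

theorem imbalance_eq (q : Queues N) :
    imbalance q = 2 * N * ∑ n, (q n : ℝ) ^ 2 - 2 * (∑ n, (q n : ℝ)) ^ 2 := by
  have h : ∀ i j : Fin N, ((q i : ℝ) - q j) ^ 2
      = (q i : ℝ) ^ 2 - 2 * ((q i : ℝ) * q j) + (q j : ℝ) ^ 2 := fun i j => by ring
  simp only [imbalance, h, Finset.sum_add_distrib, Finset.sum_sub_distrib, ← Finset.mul_sum,
    Finset.sum_const, Finset.card_univ, Fintype.card_fin, nsmul_eq_mul, ← Finset.sum_mul]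
  ring

theorem imbalance_nonneg (q : Queues N) : 0 ≤ imbalance q :=
  Finset.sum_nonneg fun _ _ => Finset.sum_nonneg fun _ _ => sq_nonneg _

theorem sq_spread_le_imbalance (hN : 0 < N) (q : Queues N) : (spread q : ℝ) ^ 2 ≤ imbalance q := by
  obtain ⟨i, j, h⟩ := exists_spread hN q
  rw [h]
  calc ((q i : ℝ) - q j) ^ 2 ≤ ∑ j, ((q i : ℝ) - q j) ^ 2 :=
        Finset.single_le_sum (f := fun j => ((q i : ℝ) - q j) ^ 2) (fun _ _ => sq_nonneg _)
          (Finset.mem_univ j)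
    _ ≤ _ := Finset.single_le_sum (f := fun i => ∑ j, ((q i : ℝ) - q j) ^ 2)
          (fun _ _ => Finset.sum_nonneg fun _ _ => sq_nonneg _) (Finset.mem_univ i)

theorem imbalance_le (q : Queues N) : imbalance q ≤ N ^ 2 * (spread q : ℝ) ^ 2 := by
  calc imbalance q ≤ ∑ _i : Fin N, ∑ _j : Fin N, (spread q : ℝ) ^ 2 :=
        Finset.sum_le_sum fun i _ => Finset.sum_le_sum fun j _ => by
          rw [← sq_abs]
          gcongr
          exact abs_sub_le_spread q i j
    _ = _ := by simp; ring

theorem abs_imbalance_sub_le {q q' : Queues N} {M : ℝ} (h : ∀ n, |(q' n : ℝ) - q n| ≤ M) :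
    |imbalance q' - imbalance q| ≤ 4 * N ^ 2 * M * (spread q + M) := by
  rw [imbalance, imbalance, ← Finset.sum_sub_distrib]
  have hterm : ∀ i j : Fin N, |((q' i : ℝ) - q' j) ^ 2 - ((q i : ℝ) - q j) ^ 2|
      ≤ 4 * M * (spread q + M) := by
    intro i j
    have h1 := h i
    have h2 := h j
    have h3 := abs_sub_le_spread q i j
    have hM : 0 ≤ M := (abs_nonneg _).trans h1
    have h4 : |((q' i : ℝ) - q' j) - ((q i : ℝ) - q j)| ≤ 2 * M := by
      rw [abs_le] at *; constructor <;> linarith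
    have h5 : |((q' i : ℝ) - q' j) + ((q i : ℝ) - q j)| ≤ 2 * (spread q + M) := by
      rw [abs_le] at *; constructor <;> linarith
    calc _ = |((q' i : ℝ) - q' j) - ((q i : ℝ) - q j)| * |((q' i : ℝ) - q' j) + ((q i : ℝ) - q j)| := by
          rw [← abs_mul]; ring_nf
      _ ≤ (2 * M) * (2 * (spread q + M)) := by gcongr
      _ = _ := by ring
  calc _ ≤ ∑ _i : Fin N, ∑ _j : Fin N, 4 * M * (spread q + M) := by
        refine (Finset.abs_sum_le_sum_abs _ _).trans (Finset.sum_le_sum fun i _ => ?_)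
        rw [← Finset.sum_sub_distrib]
        exact (Finset.abs_sum_le_sum_abs _ _).trans (Finset.sum_le_sum fun j _ => hterm i j)
    _ = _ := by simp; ring

/-- For `r ≥ (2c + 1) / κ` the cubic term absorbs `(2c + 1) r²`; below that threshold everything is
bounded. -/
theorem exists_cubic_bound {κ : ℝ} (hκ : 0 < κ) {c M : ℝ} (hc : 0 ≤ c) :
    ∃ b, 0 ≤ b ∧ ∀ r : ℝ, 0 ≤ r → c * (r + M) ^ 2 - κ * r ^ 3 ≤ b - r ^ 2 := by
  refine ⟨2 * c * M ^ 2 + (2 * c + 1) * ((2 * c + 1) / κ) ^ 2, by positivity, fun r hr => ?_⟩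
  have h1 : (r + M) ^ 2 ≤ 2 * r ^ 2 + 2 * M ^ 2 := by nlinarith [sq_nonneg (r - M)]
  have h2 : (2 * c + 1) * r ^ 2 - κ * r ^ 3 ≤ (2 * c + 1) * ((2 * c + 1) / κ) ^ 2 := by
    rcases le_total r ((2 * c + 1) / κ) with h | h
    · have : r ^ 2 ≤ ((2 * c + 1) / κ) ^ 2 := by gcongr
      have h3 : 0 ≤ κ * r ^ 3 := by positivity
      nlinarith
    · rw [div_le_iff₀ hκ] at h
      have h3 : 0 ≤ (2 * c + 1) * ((2 * c + 1) / κ) ^ 2 := by positivity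
      nlinarith [mul_le_mul_of_nonneg_right h (sq_nonneg r)]
  nlinarith [mul_le_mul_of_nonneg_left h1 hc]

/-! ### One step of the system under power-of-`d` -/

/-- Net change of queue `n` before truncation at zero. -/
def netChange (ω : (ℕ × (Fin N → ℕ)) × Fin N) (n : Fin N) : ℝ :=
  (if n = ω.2 then (ω.1.1 : ℝ) else 0) - ω.1.2 n

theorem sum_netChange (ω : (ℕ × (Fin N → ℕ)) × Fin N) : ∑ n, netChange ω n = netInput ω.1 := by
  simp [netChange, netInput, Finset.sum_sub_distrib]

theorem cast_nextQueues (q : Queues N) (ω : (ℕ × (Fin N → ℕ)) × Fin N) (n : Fin N) :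
    (nextQueues q ω.1.1 ω.2 ω.1.2 n : ℝ) = max (q n + netChange ω n) 0 := by
  rw [nextQueues, netChange]
  set a := if n = ω.2 then ω.1.1 else 0 with ha
  have ha' : (if n = ω.2 then (ω.1.1 : ℝ) else 0) = a := by rw [ha]; push_cast; rfl
  rw [ha']
  rcases le_total (ω.1.2 n) (q n + a) with h | h
  · have h' : ((ω.1.2 n : ℕ) : ℝ) ≤ ((q n + a : ℕ) : ℝ) := by exact_mod_cast h
    rw [Nat.cast_sub h]
    push_cast at h' ⊢
    rw [max_eq_left (by linarith)]
    ring
  · have h' : ((q n + a : ℕ) : ℝ) ≤ ((ω.1.2 n : ℕ) : ℝ) := by exact_mod_cast h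
    rw [Nat.sub_eq_zero_of_le h]
    push_cast at h' ⊢
    rw [max_eq_right (by linarith)]

theorem netChange_bounds {Amax Smax : ℕ} {ω : (ℕ × (Fin N → ℕ)) × Fin N}
    (hω : ω.1 ∈ slots N Amax Smax) (n : Fin N) :
    -(Smax : ℝ) ≤ netChange ω n ∧ netChange ω n ≤ Amax := by
  obtain ⟨h1, h2⟩ := mem_slots.1 hω
  have h1' : (ω.1.1 : ℝ) ≤ Amax := by exact_mod_cast h1
  have h2' : (ω.1.2 n : ℝ) ≤ Smax := by exact_mod_cast h2 n
  have h3 : (0 : ℝ) ≤ ω.1.2 n := Nat.cast_nonneg _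
  have h4 : (0 : ℝ) ≤ ω.1.1 := Nat.cast_nonneg _
  rw [netChange]
  split_ifs <;> constructor <;> linarith

theorem abs_nextQueues_sub_le {Amax Smax : ℕ} {ω : (ℕ × (Fin N → ℕ)) × Fin N}
    (hω : ω.1 ∈ slots N Amax Smax) (q : Queues N) (n : Fin N) :
    |(nextQueues q ω.1.1 ω.2 ω.1.2 n : ℝ) - q n| ≤ (Amax : ℝ) + Smax := by
  obtain ⟨h1, h2⟩ := netChange_bounds hω n
  have h3 : (0 : ℝ) ≤ q n := Nat.cast_nonneg _
  have h4 : (0 : ℝ) ≤ Amax := Nat.cast_nonneg _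
  have h5 : (0 : ℝ) ≤ Smax := Nat.cast_nonneg _
  rw [cast_nextQueues, abs_le]
  constructor
  · linarith [le_max_left ((q n : ℝ) + netChange ω n) 0]
  · have : max ((q n : ℝ) + netChange ω n) 0 ≤ q n + (Amax + Smax) := max_le (by linarith) (by linarith)
    linarith

theorem sq_nextQueues_le {Amax Smax : ℕ} {ω : (ℕ × (Fin N → ℕ)) × Fin N}
    (hω : ω.1 ∈ slots N Amax Smax) (q : Queues N) (n : Fin N) :
    (nextQueues q ω.1.1 ω.2 ω.1.2 n : ℝ) ^ 2
      ≤ (q n : ℝ) ^ 2 + 2 * q n * netChange ω n + ((Amax : ℝ) + Smax) ^ 2 := by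
  obtain ⟨h1, h2⟩ := netChange_bounds hω n
  have h4 : (0 : ℝ) ≤ Amax := Nat.cast_nonneg _
  have h5 : (0 : ℝ) ≤ Smax := Nat.cast_nonneg _
  have h3 : (nextQueues q ω.1.1 ω.2 ω.1.2 n : ℝ) ^ 2 ≤ (q n + netChange ω n) ^ 2 := by
    rw [cast_nextQueues, sq_le_sq, abs_of_nonneg (le_max_right _ _)]
    exact max_le (le_abs_self _) (abs_nonneg _)
  nlinarith

/-- Total queue length. -/
def total (q : Queues N) : ℝ := ∑ n, (q n : ℝ)

theorem total_nonneg (q : Queues N) : 0 ≤ total q :=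
  Finset.sum_nonneg fun _ _ => Nat.cast_nonneg _

/-- Total unused service in a slot. -/
def unused (q : Queues N) (ω : (ℕ × (Fin N → ℕ)) × Fin N) : ℝ :=
  ∑ n, ((nextQueues q ω.1.1 ω.2 ω.1.2 n : ℝ) - (q n + netChange ω n))

theorem total_nextQueues (q : Queues N) (ω : (ℕ × (Fin N → ℕ)) × Fin N) :
    total (nextQueues q ω.1.1 ω.2 ω.1.2) = total q + netInput ω.1 + unused q ω := by
  rw [unused, Finset.sum_sub_distrib, Finset.sum_add_distrib, sum_netChange, total, total]
  ring

theorem unused_nonneg (q : Queues N) (ω : (ℕ × (Fin N → ℕ)) × Fin N) : 0 ≤ unused q ω :=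
  Finset.sum_nonneg fun n _ => by
    rw [cast_nextQueues]; linarith [le_max_left ((q n : ℝ) + netChange ω n) 0]

theorem unused_le {Amax Smax : ℕ} {ω : (ℕ × (Fin N → ℕ)) × Fin N}
    (hω : ω.1 ∈ slots N Amax Smax) (q : Queues N) :
    unused q ω ≤ N * ((Amax : ℝ) + Smax) := by
  calc unused q ω ≤ ∑ _n : Fin N, ((Amax : ℝ) + Smax) := Finset.sum_le_sum fun n _ => by
        obtain ⟨h1, h2⟩ := netChange_bounds hω n
        have h3 : (0 : ℝ) ≤ q n := Nat.cast_nonneg _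
        have h4 : (0 : ℝ) ≤ Amax := Nat.cast_nonneg _
        have : max ((q n : ℝ) + netChange ω n) 0 ≤ q n + netChange ω n + Smax :=
          max_le (by linarith [(Nat.cast_nonneg Smax : (0 : ℝ) ≤ Smax)]) (by linarith)
        rw [cast_nextQueues]
        linarith
    _ = _ := by simp; ring

/-- Service is left unused only at empty queues, so the total queue length is then at most
a multiple of the spread. -/
theorem unused_mul_total_le {Amax Smax : ℕ} {ω : (ℕ × (Fin N → ℕ)) × Fin N}
    (hω : ω.1 ∈ slots N Amax Smax) (q : Queues N) :
    unused q ω * total (nextQueues q ω.1.1 ω.2 ω.1.2)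
      ≤ unused q ω * (N * (spread q + 2 * ((Amax : ℝ) + Smax))) := by
  rw [unused, Finset.sum_mul, Finset.sum_mul]
  refine Finset.sum_le_sum fun n _ => ?_
  rcases le_total (q n + netChange ω n) 0 with h | h
  · have h0 : (nextQueues q ω.1.1 ω.2 ω.1.2 n : ℝ) = 0 := by
      rw [cast_nextQueues, max_eq_right h]
    rw [h0]
    refine mul_le_mul_of_nonneg_left ?_ (by linarith)
    -- With `M = Amax + Smax`: queue `n` ends empty, so `q n ≤ M`; every `q m` is then at most
    -- `spread q + M`, and one slot adds at most `M`.
    calc total (nextQueues q ω.1.1 ω.2 ω.1.2)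
        ≤ ∑ _m : Fin N, (spread q + 2 * ((Amax : ℝ) + Smax)) := Finset.sum_le_sum fun m _ => by
          have h1 := abs_le.1 (abs_nextQueues_sub_le hω q n)
          have h2 := abs_le.1 (abs_nextQueues_sub_le hω q m)
          have h3 := abs_le.1 (abs_sub_le_spread q m n)
          linarith
      _ = _ := by simp; ring
  · rw [cast_nextQueues, max_eq_left h, sub_self, zero_mul, zero_mul]

end Spread

/-! ### The Markov chain of power-of-`d` -/

section PowerOfD

variable {N d : ℕ} (hd : 2 ≤ d) (hdN : d ≤ N)

/-- Dispatching probabilities of power-of-`d`. -/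
def dispatchProb (z : State N) (n : Fin N) : ℝ := ((powerOfD N d hd hdN).dispatch z n).toReal

theorem dispatchProb_nonneg (z : State N) (n : Fin N) : 0 ≤ dispatchProb hd hdN z n :=
  ENNReal.toReal_nonneg

theorem sum_dispatchProb (z : State N) : ∑ n, dispatchProb hd hdN z n = 1 :=
  sum_toReal_of_support _ _ fun _ _ => Finset.mem_univ _

/-- The arrivals are sent to shorter queues than under uniform random dispatching. -/
theorem sum_mul_dispatchProb_le (z : State N) :
    ∑ n, (z.1 n : ℝ) * dispatchProb hd hdN z n ≤ total z.1 / N - spread z.1 / N := by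
  have hN : 0 < N := by omega
  set σ := Tuple.sort z.1
  have hσ : IsSorting z.1 σ := Tuple.monotone_sort z.1
  obtain ⟨i, j, hij⟩ := exists_spread hN z.1
  have h1 := (innerEquiv_powerOfD hd hdN z hσ).2
  have h2 : ∑ i, (z.1 (σ i) : ℝ) * sortedDispatch (powerOfD N d hd hdN) z σ i
      = ∑ n, (z.1 n : ℝ) * dispatchProb hd hdN z n :=
    Equiv.sum_comp σ fun n => (z.1 n : ℝ) * dispatchProb hd hdN z n
  have h3 : ∑ i, (z.1 (σ i) : ℝ) = total z.1 := Equiv.sum_comp σ fun n => (z.1 n : ℝ)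
  -- For equal rates `Delta` is `p - 1 / N` whatever the rate, so rate `1` may be used.
  have h4 := (deltaTilted_powerOfD hd hdN one_pos σ).sum_mul_Delta_le hσ (by
    have : (N : ℝ) ≠ 0 := by exact_mod_cast hN.ne'
    simp [Delta_const hN one_pos, Finset.sum_sub_distrib,
      sum_powerOfDProb (by omega : 1 ≤ d) hdN, this]) i j
  simp only [Delta_const hN one_pos, mul_sub, Finset.sum_sub_distrib, ← Finset.sum_mul, h3] at h4
  rw [← h2, h1, hij]
  have h5 : total z.1 * (1 / (N : ℝ)) = total z.1 / N := by ring
  have h6 : 1 / (N : ℝ) * ((z.1 i : ℝ) - z.1 j) = ((z.1 i : ℝ) - z.1 j) / N := by ring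
  rw [← mul_sub, h5, h6] at h4
  linarith

variable {A : PMF ℕ} {S : PMF (Fin N → ℕ)} {lam μ : ℝ} {Amax Smax : ℕ}

/-- The innovations of a slot: arrivals, services and the chosen server. -/
def innovations (N Amax Smax : ℕ) : Finset ((ℕ × (Fin N → ℕ)) × Fin N) :=
  slots N Amax Smax ×ˢ Finset.univ

/-- The probability of an innovation in a given state. -/
def weight (A : PMF ℕ) (S : PMF (Fin N → ℕ)) (z : State N) (ω : (ℕ × (Fin N → ℕ)) × Fin N) : ℝ :=
  slotProb A S ω.1 * dispatchProb hd hdN z ω.2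

/-- The next state. -/
def move (z : State N) (ω : (ℕ × (Fin N → ℕ)) × Fin N) : State N :=
  (nextQueues z.1 ω.1.1 ω.2 ω.1.2, ∅)

theorem mem_slots_of_mem_innovations {ω : (ℕ × (Fin N → ℕ)) × Fin N}
    (hω : ω ∈ innovations N Amax Smax) : ω.1 ∈ slots N Amax Smax :=
  (Finset.mem_product.1 hω).1

theorem sum_weight_mul (z : State N) (φ : ℕ × (Fin N → ℕ) → ℝ) :
    ∑ ω ∈ innovations N Amax Smax, weight hd hdN A S z ω * φ ω.1
      = ∑ ν ∈ slots N Amax Smax, slotProb A S ν * φ ν := by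
  rw [innovations, Finset.sum_product]
  refine Finset.sum_congr rfl fun ν _ => ?_
  have : ∀ i, weight hd hdN A S z (ν, i) * φ ν
      = slotProb A S ν * φ ν * dispatchProb hd hdN z i := fun i => by
    simp only [weight]; ring
  rw [Finset.sum_congr rfl fun i _ => this i, ← Finset.mul_sum, sum_dispatchProb, mul_one]

theorem powerOfD_finiteRep (hA : IsArrivalLaw A lam Amax)
    (hS : IsServiceLaw S (fun _ => μ) Smax) :
    FiniteRep (step (powerOfD N d hd hdN) A S) (innovations N Amax Smax) (weight hd hdN A S)
      move where
  nonneg z ω _ := mul_nonneg (slotProb_nonneg A S ω.1) (dispatchProb_nonneg hd hdN z ω.2)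
  sum_one z := by
    simpa [sum_slotProb hA hS] using
      sum_weight_mul (A := A) (S := S) (Amax := Amax) (Smax := Smax) hd hdN z fun _ => 1
  ev_eq z f := by
    rw [step, ev_bind, ev_eq_sum A _ hA.mem_range, innovations, Finset.sum_product, slots,
      Finset.sum_product]
    refine Finset.sum_congr rfl fun a _ => ?_
    rw [ev_bind, ev_eq_sum S _ hS.mem_piFinset, Finset.mul_sum]
    refine Finset.sum_congr rfl fun s _ => ?_
    rw [ev_bind, ev_eq_sum _ Finset.univ fun _ _ => Finset.mem_univ _, Finset.mul_sum,
      Finset.mul_sum]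
    refine Finset.sum_congr rfl fun i _ => ?_
    have hu : (powerOfD N d hd hdN).update z a i (nextQueues z.1 a i s) = PMF.pure ∅ := rfl
    rw [hu, ev_map, ev_pure, weight, slotProb, dispatchProb,
      ENNReal.ofReal_mul (mul_nonneg ENNReal.toReal_nonneg ENNReal.toReal_nonneg),
      ENNReal.ofReal_mul ENNReal.toReal_nonneg, ENNReal.ofReal_toReal (A.apply_ne_top a),
      ENNReal.ofReal_toReal (S.apply_ne_top s), ENNReal.ofReal_toReal (PMF.apply_ne_top _ i),
      mul_assoc, mul_assoc]
    rfl

theorem sum_weight_netChange (hA : IsArrivalLaw A lam Amax)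
    (hS : IsServiceLaw S (fun _ => μ) Smax) (z : State N) (c : Fin N → ℝ) :
    ∑ ω ∈ innovations N Amax Smax, weight hd hdN A S z ω * ∑ n, c n * netChange ω n
      = lam * ∑ n, c n * dispatchProb hd hdN z n - μ * ∑ n, c n := by
  have h := sum_slots_linear hA hS (∑ n, c n * dispatchProb hd hdN z n) c
  rw [← Finset.sum_mul, mul_comm _ μ] at h
  rw [← h, innovations, Finset.sum_product]
  refine Finset.sum_congr rfl fun ν _ => ?_
  have h1 : ∀ i, ∑ n, c n * netChange (ν, i) n = c i * ν.1 - ∑ n, c n * (ν.2 n : ℝ) := by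
    intro i
    simp [netChange, mul_sub, Finset.sum_sub_distrib]
  have h2 : ∀ i, weight hd hdN A S z (ν, i) * ∑ n, c n * netChange (ν, i) n
      = slotProb A S ν * (ν.1 * (c i * dispatchProb hd hdN z i))
        - slotProb A S ν * (∑ n, c n * (ν.2 n : ℝ)) * dispatchProb hd hdN z i := by
    intro i
    rw [h1, weight]
    ring
  rw [Finset.sum_congr rfl fun i _ => h2 i, Finset.sum_sub_distrib, ← Finset.mul_sum,
    ← Finset.mul_sum, ← Finset.mul_sum, sum_dispatchProb]
  ring

/-- Drift of the sum of squared queue lengths. -/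
theorem drift_sum_sq (hA : IsArrivalLaw A lam Amax)
    (hS : IsServiceLaw S (fun _ => μ) Smax) (z : State N) :
    ∑ ω ∈ innovations N Amax Smax, weight hd hdN A S z ω *
        (∑ n, ((move z ω).1 n : ℝ) ^ 2 - ∑ n, (z.1 n : ℝ) ^ 2)
      ≤ N * ((Amax : ℝ) + Smax) ^ 2 - 2 * (N * μ - lam) / N * total z.1 := by
  have h := powerOfD_finiteRep hd hdN hA hS
  have hN : (0 : ℝ) < N := by exact_mod_cast (by omega : 0 < N)
  calc _ ≤ ∑ ω ∈ innovations N Amax Smax, weight hd hdN A S z ω *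
        (∑ n, (2 * (z.1 n : ℝ)) * netChange ω n + N * ((Amax : ℝ) + Smax) ^ 2) := by
        refine h.sum_mono z fun ω hω => ?_
        have h1 := Finset.sum_le_sum fun n (_ : n ∈ Finset.univ) =>
          sq_nextQueues_le (mem_slots_of_mem_innovations hω) z.1 n
        simp only [Finset.sum_add_distrib, Finset.sum_const, Finset.card_univ, Fintype.card_fin,
          nsmul_eq_mul] at h1
        simp only [move]
        linarith
    _ = lam * (2 * ∑ n, (z.1 n : ℝ) * dispatchProb hd hdN z n) - μ * (2 * total z.1)
        + N * ((Amax : ℝ) + Smax) ^ 2 := by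
      simp only [mul_add, Finset.sum_add_distrib, h.sum_const]
      rw [sum_weight_netChange hd hdN hA hS]
      simp only [total, Finset.mul_sum, mul_assoc]
    _ ≤ _ := by
      have h2 : ∑ n, (z.1 n : ℝ) * dispatchProb hd hdN z n ≤ total z.1 / N :=
        (sum_mul_dispatchProb_le hd hdN z).trans (sub_le_self _ (by positivity))
      have h3 := mul_le_mul_of_nonneg_left h2 hA.nonneg
      have h4 : 2 * (N * μ - lam) / N * total z.1
          = 2 * (μ * total z.1) - 2 * (lam * (total z.1 / N)) := by field_simp
      linarith

/-- Drift of the imbalance: it does not depend on the load. -/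
theorem drift_imbalance (hA : IsArrivalLaw A lam Amax)
    (hS : IsServiceLaw S (fun _ => μ) Smax) (z : State N) :
    ∑ ω ∈ innovations N Amax Smax, weight hd hdN A S z ω *
        (imbalance (move z ω).1 - imbalance z.1)
      ≤ 2 * N ^ 2 * ((Amax : ℝ) + Smax) ^ 2 - 4 * lam * spread z.1 := by
  have h := powerOfD_finiteRep hd hdN hA hS
  have hN : (0 : ℝ) < N := by exact_mod_cast (by omega : 0 < N)
  -- These coefficients are the gradient of the imbalance. They sum to zero, so equal service rates
  -- contribute nothing and only the arrivals drive the drift.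
  have hc : ∑ n, (4 * N * (z.1 n : ℝ) - 4 * total z.1) = 0 := by
    simp only [Finset.sum_sub_distrib, ← Finset.mul_sum, Finset.sum_const, Finset.card_univ,
      Fintype.card_fin, nsmul_eq_mul, total]
    ring
  calc _ ≤ ∑ ω ∈ innovations N Amax Smax, weight hd hdN A S z ω *
        (∑ n, (4 * N * (z.1 n : ℝ) - 4 * total z.1) * netChange ω n
          + 2 * N ^ 2 * ((Amax : ℝ) + Smax) ^ 2) := by
        refine h.sum_mono z fun ω hω => ?_
        have h1 := Finset.sum_le_sum fun n (_ : n ∈ Finset.univ) =>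
          sq_nextQueues_le (mem_slots_of_mem_innovations hω) z.1 n
        simp only [Finset.sum_add_distrib, Finset.sum_const, Finset.card_univ, Fintype.card_fin,
          nsmul_eq_mul, mul_assoc, ← Finset.mul_sum] at h1
        have h2 := total_nextQueues z.1 ω
        have h3 := unused_nonneg z.1 ω
        have h4 := total_nonneg z.1
        have h5 : ∑ n, (4 * N * (z.1 n : ℝ) - 4 * total z.1) * netChange ω n
            = 4 * N * ∑ n, (z.1 n : ℝ) * netChange ω n - 4 * total z.1 * netInput ω.1 := by
          simp only [sub_mul, Finset.sum_sub_distrib, ← sum_netChange, Finset.mul_sum, mul_assoc]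
        rw [h5, imbalance_eq, imbalance_eq]
        simp only [move]
        change _ - 2 * total _ ^ 2 - (_ - 2 * total z.1 ^ 2) ≤ _
        -- The squared total enters the imbalance with a minus sign, so a lower bound is needed;
        -- unused service, being nonnegative, helps.
        have h6 : total z.1 ^ 2 + 2 * (total z.1 * netInput ω.1)
            ≤ total (nextQueues z.1 ω.1.1 ω.2 ω.1.2) ^ 2 := by
          rw [h2]
          nlinarith [sq_nonneg (netInput ω.1 + unused z.1 ω), mul_nonneg h4 h3]
        have h7 := mul_le_mul_of_nonneg_left h1 hN.le
        nlinarith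
    _ = lam * ∑ n, (4 * N * (z.1 n : ℝ) - 4 * total z.1) * dispatchProb hd hdN z n
        + 2 * N ^ 2 * ((Amax : ℝ) + Smax) ^ 2 := by
      simp only [mul_add _ (Finset.sum _ _), Finset.sum_add_distrib, h.sum_const]
      rw [sum_weight_netChange hd hdN hA hS, hc, mul_zero, sub_zero]
    _ ≤ _ := by
      have h2 := mul_le_mul_of_nonneg_left (sum_mul_dispatchProb_le hd hdN z) hN.le
      have h3 : (N : ℝ) * (total z.1 / N - spread z.1 / N) = total z.1 - spread z.1 := by
        field_simp
      have h4 : ∑ n, (4 * N * (z.1 n : ℝ) - 4 * total z.1) * dispatchProb hd hdN z n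
          = 4 * (N * ∑ n, (z.1 n : ℝ) * dispatchProb hd hdN z n) - 4 * total z.1 := by
        simp only [sub_mul, Finset.sum_sub_distrib, ← Finset.mul_sum, sum_dispatchProb, mul_assoc,
          mul_one]
      rw [h4]
      nlinarith [mul_le_mul_of_nonneg_left (h2.trans_eq h3) hA.nonneg]

/-- The imbalance itself would only control the first moment of the spread. Since it is at least the
squared spread, its square has a drift of order `-lam * spread³`, against quadratic error terms;
this controls the second moment. -/
theorem drift_sq_imbalance (hA : IsArrivalLaw A lam Amax)
    (hS : IsServiceLaw S (fun _ => μ) Smax) (z : State N) :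
    ∑ ω ∈ innovations N Amax Smax, weight hd hdN A S z ω *
        (imbalance (move z ω).1 ^ 2 - imbalance z.1 ^ 2)
      ≤ 20 * N ^ 4 * ((Amax : ℝ) + Smax) ^ 2 * (spread z.1 + ((Amax : ℝ) + Smax)) ^ 2
        - 8 * lam * (spread z.1 : ℝ) ^ 3 := by
  have h := powerOfD_finiteRep hd hdN hA hS
  have hN : 0 < N := by omega
  set M : ℝ := (Amax : ℝ) + Smax with hM
  have hM0 : 0 ≤ M := by positivity
  set r : ℝ := (spread z.1 : ℝ) with hr
  have hr0 : 0 ≤ r := Nat.cast_nonneg _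
  set W := imbalance z.1
  have hW0 : 0 ≤ W := imbalance_nonneg _
  have hW1 : r ^ 2 ≤ W := sq_spread_le_imbalance hN _
  have hW2 : W ≤ N ^ 2 * r ^ 2 := imbalance_le _
  have hd1 : ∑ ω ∈ innovations N Amax Smax, weight hd hdN A S z ω *
      (imbalance (move z ω).1 - W) ≤ 2 * N ^ 2 * M ^ 2 - 4 * lam * r :=
    drift_imbalance hd hdN hA hS z
  calc _ ≤ ∑ ω ∈ innovations N Amax Smax, weight hd hdN A S z ω *
        ((imbalance (move z ω).1 - W) * (2 * W) + (4 * N ^ 2 * M * (r + M)) ^ 2) := by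
        refine h.sum_mono z fun ω hω => ?_
        have h1 : |imbalance (move z ω).1 - W| ≤ 4 * N ^ 2 * M * (r + M) :=
          abs_imbalance_sub_le fun n =>
            abs_nextQueues_sub_le (mem_slots_of_mem_innovations hω) z.1 n
        have h2 : (imbalance (move z ω).1 - W) ^ 2 ≤ (4 * N ^ 2 * M * (r + M)) ^ 2 := by
          rw [← sq_abs]; gcongr
        nlinarith
    _ = (∑ ω ∈ innovations N Amax Smax, weight hd hdN A S z ω * (imbalance (move z ω).1 - W))
        * (2 * W) + (4 * N ^ 2 * M * (r + M)) ^ 2 := by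
      rw [Finset.sum_mul, ← h.sum_const z ((4 * N ^ 2 * M * (r + M)) ^ 2),
        ← Finset.sum_add_distrib]
      exact Finset.sum_congr rfl fun ω _ => by rw [h.sum_const]; ring
    _ ≤ (2 * N ^ 2 * M ^ 2 - 4 * lam * r) * (2 * W) + (4 * N ^ 2 * M * (r + M)) ^ 2 := by
      gcongr
    _ ≤ _ := by
      have h3 : lam * r * r ^ 2 ≤ lam * r * W :=
        mul_le_mul_of_nonneg_left hW1 (mul_nonneg hA.nonneg hr0)
      -- The constant `20` is `4` from this term plus `16` from the squared increment.
      have h4 : (4 * N ^ 2 * M ^ 2) * W ≤ (4 * N ^ 2 * M ^ 2) * (N ^ 2 * (r + M) ^ 2) := by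
        refine mul_le_mul_of_nonneg_left (hW2.trans ?_) (by positivity)
        gcongr
        linarith
      nlinarith

/-- State space collapse: the second moment of the spread is bounded uniformly in the load. -/
theorem exists_spread_bound {κ : ℝ} (hκ : 0 < κ) (Amax Smax : ℕ) :
    ∃ b : ℝ, 0 ≤ b ∧ ∀ (A : PMF ℕ) (S : PMF (Fin N → ℕ)) (lam μ : ℝ),
      IsArrivalLaw A lam Amax → IsServiceLaw S (fun _ => μ) Smax → κ ≤ lam →
      ∀ π, IsStationary (step (powerOfD N d hd hdN) A S) π →
      (Summable fun z : State N => (π z).toReal * (spread z.1 : ℝ) ^ 2) ∧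
        ∑' z : State N, (π z).toReal * (spread z.1 : ℝ) ^ 2 ≤ b := by
  obtain ⟨b, hb, hbd⟩ := exists_cubic_bound (κ := 8 * κ) (by positivity)
    (c := 20 * N ^ 4 * ((Amax : ℝ) + Smax) ^ 2) (M := (Amax : ℝ) + Smax) (by positivity)
  refine ⟨b, hb, fun A S lam μ hA hS hlam π hπ => ?_⟩
  refine (powerOfD_finiteRep hd hdN hA hS).tsum_le hπ (f := fun z => imbalance z.1 ^ 2)
    (fun z => sq_nonneg _) (fun z => sq_nonneg _) hb fun z => ?_
  have hr : (0 : ℝ) ≤ spread z.1 := Nat.cast_nonneg _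
  refine (drift_sq_imbalance hd hdN hA hS z).trans (le_trans ?_ (hbd _ hr))
  have : 0 ≤ (spread z.1 : ℝ) ^ 3 := by positivity
  nlinarith

/-! ### Stationary laws of power-of-`d` and their mean total queue length -/

theorem powerOfD_summable_total (hA : IsArrivalLaw A lam Amax)
    (hS : IsServiceLaw S (fun _ => μ) Smax) (hlt : lam < N * μ) {π : PMF (State N)}
    (hπ : IsStationary (step (powerOfD N d hd hdN) A S) π) :
    Summable fun z => (π z).toReal * total z.1 := by
  have hN : (0 : ℝ) < N := by exact_mod_cast (by omega : 0 < N)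
  have hε : 0 < N * μ - lam := sub_pos.2 hlt
  have h := ((powerOfD_finiteRep hd hdN hA hS).tsum_le hπ (f := fun z => ∑ n, (z.1 n : ℝ) ^ 2)
    (g := fun z => 2 * (N * μ - lam) / N * total z.1) (fun z => Finset.sum_nonneg fun _ _ =>
      sq_nonneg _) (fun z => mul_nonneg (by positivity) (total_nonneg _)) (by positivity)
    (drift_sum_sq hd hdN hA hS)).1
  refine (h.mul_left (2 * (N * μ - lam) / N)⁻¹).congr fun q => ?_
  field_simp

theorem finite_total_le (N : ℕ) (M : ℝ) : {z : State N | total z.1 ≤ M}.Finite := by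
  have h : {q : Queues N | ∀ n, q n ∈ Set.Iic ⌊M⌋₊}.Finite :=
    Set.Finite.pi' fun _ => Set.finite_Iic _
  refine (h.prod (Set.finite_univ (α := Finset (Fin N)))).subset fun z hz => ⟨fun n => ?_, trivial⟩
  refine Nat.le_floor (le_trans ?_ hz)
  exact Finset.single_le_sum (f := fun n => (z.1 n : ℝ)) (fun _ _ => Nat.cast_nonneg _)
    (Finset.mem_univ n)

theorem powerOfD_exists_stationary (hA : IsArrivalLaw A lam Amax)
    (hS : IsServiceLaw S (fun _ => μ) Smax) (hlt : lam < N * μ) :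
    ∃ π, IsStationary (step (powerOfD N d hd hdN) A S) π := by
  have hN : (0 : ℝ) < N := by exact_mod_cast (by omega : 0 < N)
  have hε : 0 < N * μ - lam := sub_pos.2 hlt
  refine (powerOfD_finiteRep hd hdN hA hS).exists_stationary
    (f := fun z => ∑ n, (z.1 n : ℝ) ^ 2)
    (g := fun z => 2 * (N * μ - lam) / N * total z.1) (fun z => Finset.sum_nonneg fun _ _ =>
      sq_nonneg _) (fun z => mul_nonneg (by positivity) (total_nonneg _)) (by positivity)
    (drift_sum_sq hd hdN hA hS) (fun _ => 0, ∅) fun M => ?_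
  refine (finite_total_le N (M / (2 * (N * μ - lam) / N))).subset fun z hz => ?_
  change total z.1 ≤ _
  rw [le_div_iff₀ (by positivity), mul_comm]
  exact hz

/-- The second moment identity for the total queue length, with the cross term controlled by the
spread through `unused_mul_total_le`. -/
theorem powerOfD_abs_mean_sub_le (hA : IsArrivalLaw A lam Amax)
    (hS : IsServiceLaw S (fun _ => μ) Smax) (hlt : lam < N * μ) {π : PMF (State N)}
    (hπ : IsStationary (step (powerOfD N d hd hdN) A S) π) {b η : ℝ} (hη : 0 < η)
    (hs : Summable fun z : State N => (π z).toReal * (spread z.1 : ℝ) ^ 2)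
    (hb : ∑' z : State N, (π z).toReal * (spread z.1 : ℝ) ^ 2 ≤ b) :
    |2 * (N * μ - lam) * ∑' z, (π z).toReal * total z.1
        - (variance (fun a : ℕ => (a : ℝ)) A.toMeasure + serviceVar S (fun _ => μ)
          + (N * μ - lam) ^ 2)|
      ≤ η * (N ^ 2 * (2 * b + 8 * ((Amax : ℝ) + Smax) ^ 2))
        + (N * ((Amax : ℝ) + Smax) / η + N * ((Amax : ℝ) + Smax)) * (N * μ - lam) := by
  have hN : 0 < N := by omega
  set M : ℝ := (Amax : ℝ) + Smax with hM
  have h1 := hasSum_toReal π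
  have h2 : HasSum (fun z : State N => (π z).toReal *
      (N ^ 2 * (2 * (spread z.1 : ℝ) ^ 2 + 8 * M ^ 2)))
      (N ^ 2 * (2 * (∑' z : State N, (π z).toReal * (spread z.1 : ℝ) ^ 2) + 8 * M ^ 2)) := by
    have h3 := ((hs.hasSum.mul_left 2).add (h1.mul_right (8 * M ^ 2))).mul_left ((N : ℝ) ^ 2)
    rw [one_mul] at h3
    refine h3.congr_fun fun z => ?_
    ring
  have hle : ∀ z : State N, (N * ((spread z.1 : ℝ) + 2 * M)) ^ 2
      ≤ N ^ 2 * (2 * (spread z.1 : ℝ) ^ 2 + 8 * M ^ 2) := by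
    intro z
    rw [mul_pow]
    gcongr
    nlinarith [sq_nonneg ((spread z.1 : ℝ) - 2 * M)]
  have h3 : Summable fun z : State N => (π z).toReal * (N * ((spread z.1 : ℝ) + 2 * M)) ^ 2 :=
    summable_of_abs_le π (fun z => by rw [abs_of_nonneg (sq_nonneg _)]; exact hle z) h2.summable
  have hsum : ∑ _n : Fin N, μ = N * μ := by simp
  have hn := sum_slots_netInput hA hS
  have hn2 := sum_slots_netInput_sq hA hS
  rw [hsum] at hn hn2
  refine (powerOfD_finiteRep hd hdN hA hS).abs_mean_sub_le hπ (ℓ := fun z => total z.1)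
    (H := fun z => N * ((spread z.1 : ℝ) + 2 * M)) (X := fun ω => netInput ω.1)
    (u := fun z ω => unused z.1 ω) (fun z => total_nonneg _) hη
    (fun z ω _ => total_nextQueues z.1 ω)
    (fun ω hω => abs_netInput_le hN (mem_slots_of_mem_innovations hω))
    (fun z ω _ => unused_nonneg _ _)
    (fun z ω hω => unused_le (mem_slots_of_mem_innovations hω) _)
    (fun z => ?_) (fun z => ?_)
    (fun z ω hω => unused_mul_total_le (mem_slots_of_mem_innovations hω) z.1)
    (powerOfD_summable_total hd hdN hA hS hlt hπ) h3 ?_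
  · rw [sum_weight_mul hd hdN z netInput, hn]; ring
  · rw [sum_weight_mul hd hdN z fun ν => netInput ν ^ 2, hn2]
  · refine (h3.tsum_le_tsum (fun z => mul_le_mul_of_nonneg_left (hle z) ENNReal.toReal_nonneg)
      h2.summable).trans ?_
    rw [h2.tsum_eq]
    gcongr

end PowerOfD

/-! ### Heavy-traffic limit -/

/-- The choice `η = √ε` balances the two errors: `η B` and `C ε / η` are both of order `√ε`. -/
theorem tendsto_scaled_mean {F m : ℝ → ℝ} {B C l : ℝ}
    (hb : ∀ᶠ ε in 𝓝[>] (0 : ℝ), |2 * ε * F ε - m ε| ≤ √ε * B + (C / √ε + C) * ε)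
    (hm : Tendsto m (𝓝[>] 0) (𝓝 (2 * l))) : Tendsto (fun ε => ε * F ε) (𝓝[>] 0) (𝓝 l) := by
  have h1 : Tendsto (fun ε : ℝ => √ε * B + C * √ε + C * ε) (𝓝[>] 0) (𝓝 0) := by
    have : Continuous fun ε : ℝ => √ε * B + C * √ε + C * ε := by fun_prop
    exact (this.tendsto' 0 0 (by simp)).mono_left nhdsWithin_le_nhds
  have h2 : Tendsto (fun ε => 2 * ε * F ε - m ε) (𝓝[>] 0) (𝓝 0) := by
    refine squeeze_zero_norm' ?_ h1
    filter_upwards [hb, self_mem_nhdsWithin] with ε hε hpos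
    have hpos' : 0 < ε := hpos
    refine hε.trans (le_of_eq ?_)
    have : C / √ε * ε = C * √ε := by
      rw [div_mul_eq_mul_div, mul_div_assoc, Real.div_sqrt]
    rw [add_mul, this]
    ring
  have h3 := (h2.add hm).const_mul (1 / 2)
  have h4 : (1 : ℝ) / 2 * (0 + 2 * l) = l := by ring
  rw [h4] at h3
  refine h3.congr fun ε => ?_
  ring

theorem meanTotal_eq {N : ℕ} {π : PMF (State N)}
    (h : Summable fun z => (π z).toReal * total z.1) :
    meanTotal π = ENNReal.ofReal (∑' z, (π z).toReal * total z.1) := by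
  rw [← ev_ofReal π (fun z => total_nonneg z.1) h]
  refine tsum_congr fun z => ?_
  simp only [total]
  rw [← Nat.cast_sum, ENNReal.ofReal_natCast]

theorem meanPooled_eq {ϖ : PMF ℕ} (h : Summable fun q => (ϖ q).toReal * (q : ℝ)) :
    meanPooled ϖ = ENNReal.ofReal (∑' q, (ϖ q).toReal * (q : ℝ)) := by
  rw [← ev_ofReal ϖ (fun q => Nat.cast_nonneg q) h]
  exact tsum_congr fun q => by simp only [ENNReal.ofReal_natCast]

theorem heavyTrafficDelayOptimal_powerOfD {N d : ℕ} (hd : 2 ≤ d) (hdN : d ≤ N) {μ : ℝ}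
    (hμ : 0 < μ) : HeavyTrafficDelayOptimal (powerOfD N d hd hdN) (fun _ => μ) := by
  intro S Smax hS ε₀ hε₀ A Amax hA σsq hvar
  have hN : 0 < N := by omega
  have hNr : (0 : ℝ) < N := by exact_mod_cast hN
  have hsum : ∑ _n : Fin N, μ = N * μ := by simp
  rw [hsum] at hA
  have hlt : ∀ ε ∈ Set.Ioo 0 ε₀, N * μ - ε < N * μ := fun ε hε => by linarith [hε.1]
  have hlt' : ∀ ε ∈ Set.Ioo 0 ε₀, N * μ - ε < ∑ _n : Fin N, μ := fun ε hε => by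
    rw [hsum]; exact hlt ε hε
  refine ⟨fun ε hε => ⟨powerOfD_exists_stationary hd hdN (hA ε hε) hS (hlt ε hε),
    pooled_exists_stationary hN (hA ε hε) hS (hlt' ε hε)⟩, fun π ϖ hst => ?_⟩
  -- For `ε < N μ / 2` the arrival rate stays above `N μ / 2`, so a single bound `b` on the spread
  -- serves all small `ε`.
  obtain ⟨b, -, hb⟩ := exists_spread_bound hd hdN (κ := N * μ / 2) (by positivity) Amax Smax
  set v := serviceVar S (fun _ => μ) with hv
  set m : ℝ → ℝ := fun ε => variance (fun a : ℕ => (a : ℝ)) (A ε).toMeasure + v + ε ^ 2 with hm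
  have hmlim : Tendsto m (𝓝[>] 0) (𝓝 (2 * ((σsq + v) / 2))) := by
    have h1 : Tendsto (fun ε : ℝ => ε ^ 2) (𝓝[>] 0) (𝓝 0) :=
      ((continuous_pow 2).tendsto' 0 0 (by simp)).mono_left nhdsWithin_le_nhds
    have h2 := (hvar.add_const v).add h1
    have h3 : 2 * ((σsq + v) / 2) = σsq + v + 0 := by ring
    rw [h3]
    exact h2
  have hsmall : ∀ᶠ ε in 𝓝[>] (0 : ℝ), ε ∈ Set.Ioo 0 ε₀ := Ioo_mem_nhdsGT hε₀
  have hsmall' : ∀ᶠ ε in 𝓝[>] (0 : ℝ), ε ∈ Set.Ioo 0 (N * μ / 2) := Ioo_mem_nhdsGT (by positivity)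
  have hε : ∀ ε : ℝ, N * μ - (N * μ - ε) = ε := fun ε => by ring
  refine ⟨(σsq + v) / 2, ?_, ?_⟩
  · have h1 := tendsto_scaled_mean (F := fun ε => ∑' z, (π ε z).toReal * total z.1) (m := m)
      (B := N ^ 2 * (2 * b + 8 * ((Amax : ℝ) + Smax) ^ 2)) (C := N * ((Amax : ℝ) + Smax))
      (l := (σsq + v) / 2) (by
        filter_upwards [hsmall, hsmall'] with ε h1 h2
        obtain ⟨h3, h4⟩ := hb (A ε) S _ μ (hA ε h1) hS (by linarith [h2.2]) _ (hst ε h1).1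
        have h5 := powerOfD_abs_mean_sub_le hd hdN (hA ε h1) hS (hlt ε h1) (hst ε h1).1
          (Real.sqrt_pos.2 h1.1) h3 h4
        rwa [hε] at h5) hmlim
    refine (ENNReal.tendsto_ofReal h1).congr' ?_
    filter_upwards [hsmall] with ε h2
    rw [meanTotal_eq (powerOfD_summable_total hd hdN (hA ε h2) hS (hlt ε h2) (hst ε h2).1),
      ENNReal.ofReal_mul h2.1.le]
  · have h1 := tendsto_scaled_mean (F := fun ε => ∑' q, (ϖ ε q).toReal * (q : ℝ)) (m := m)
      (B := 0) (C := N * ((Amax : ℝ) + Smax)) (l := (σsq + v) / 2) (by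
        filter_upwards [hsmall] with ε h1
        have h5 := pooled_abs_mean_sub_le hN (hA ε h1) hS (hlt' ε h1) (hst ε h1).2
          (Real.sqrt_pos.2 h1.1)
        rw [hsum, hε] at h5
        rwa [mul_zero, zero_add]) hmlim
    refine (ENNReal.tendsto_ofReal h1).congr' ?_
    filter_upwards [hsmall] with ε h2
    rw [meanPooled_eq (pooled_summable hN (hA ε h2) hS (hlt' ε h2) (hst ε h2).2),
      ENNReal.ofReal_mul h2.1.le]

/-! ### Geometric drift and stability -/

/-- The bound `f x + b'` reproduces itself under one step, hence holds at all times. -/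
theorem ev_iter_le {α : Type} {K : α → PMF α} {f : α → ℝ≥0∞} {ρ b b' : ℝ≥0∞}
    (hd : ∀ x, ev (K x) f ≤ ρ * f x + b) (hρ : ρ ≤ 1) (hb : ρ * b' + b ≤ b') (x : α) (t : ℕ) :
    ev (iter K (PMF.pure x) t) f ≤ f x + b' := by
  induction t with
  | zero => rw [iter, ev_pure]; exact le_self_add
  | succ t ih =>
    rw [iter, ev_bind]
    refine (ev_mono _ hd).trans ?_
    rw [ev_add, ev_const, ev_const_mul]
    calc ρ * ev (iter K (PMF.pure x) t) f + b ≤ ρ * (f x + b') + b := by gcongr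
      _ = ρ * f x + (ρ * b' + b) := by ring
      _ ≤ f x + b' := add_le_add (mul_le_of_le_one_left' hρ) hb

theorem toOuterMeasure_eq_ev {α : Type*} (p : PMF α) (s : Set α) :
    p.toOuterMeasure s = ev p (s.indicator 1) := by
  rw [PMF.toOuterMeasure_apply]
  refine tsum_congr fun x => ?_
  by_cases hx : x ∈ s <;> simp [hx]

theorem lawAt_eq_iter {N : ℕ} (P : Policy N) (A : PMF ℕ) (S : PMF (Fin N → ℕ))
    (ν : PMF (Queues N)) (t : ℕ) :
    lawAt P A S ν t = iter (step P A S) (lawAt P A S ν 0) t := by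
  induction t with
  | zero => rfl
  | succ t ih => exact congrArg (fun p => p.bind (step P A S)) ih

/-- A geometric drift condition implies stability from every initial law. -/
theorem FiniteRep.stable {N : ℕ} {Ω : Type} {K : State N → PMF (State N)} {O : Finset Ω}
    {w : State N → Ω → ℝ} {F : State N → Ω → State N} (h : FiniteRep K O w F)
    {f : State N → ℝ} {ρ b c : ℝ} (hρ0 : 0 ≤ ρ) (hρ1 : ρ < 1) (hb : 0 ≤ b) (hc : 0 < c)
    (hf : ∀ z, c * total z.1 ≤ f z)
    (hd : ∀ z, ∑ ω ∈ O, w z ω * f (F z ω) ≤ ρ * f z + b) (L₀ : PMF (State N)) :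
    Stable (iter K L₀) := by
  have hf0 : ∀ z, 0 ≤ f z := fun z => (mul_nonneg hc.le (total_nonneg _)).trans (hf z)
  -- The fixed point of `y ↦ ρ y + b`.
  set b' := b / (1 - ρ) with hb'
  have hb0 : 0 ≤ b' := div_nonneg hb (by linarith)
  have hbb : ρ * b' + b = b' := by
    have : 1 - ρ ≠ 0 := by linarith
    rw [hb']; field_simp; ring
  have hit : ∀ z t, ev (iter K (PMF.pure z) t) (fun y => ENNReal.ofReal (f y))
      ≤ ENNReal.ofReal (f z + b') := by
    intro z t
    rw [ENNReal.ofReal_add (hf0 z) hb0]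
    refine ev_iter_le (ρ := ENNReal.ofReal ρ) (b := ENNReal.ofReal b) (fun x => ?_)
      (by simpa using hρ1.le) ?_ z t
    · rw [h.ev_ofReal x hf0, ← ENNReal.ofReal_mul hρ0,
        ← ENNReal.ofReal_add (mul_nonneg hρ0 (hf0 x)) hb]
      exact ENNReal.ofReal_le_ofReal (hd x)
    · rw [← ENNReal.ofReal_mul hρ0, ← ENNReal.ofReal_add (mul_nonneg hρ0 hb0) hb, hbb]
  -- `f` may have infinite mean under `L₀`. Markov's inequality is therefore applied for each
  -- initial state and capped at `1`; dominated convergence over the initial law then gives decay in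
  -- `C`, uniformly in `t`.
  set g : ℝ → State N → ℝ := fun C z => min 1 ((f z + b') / (c * C)) with hg
  have hg0 : ∀ C, 0 < C → ∀ z, 0 ≤ g C z := fun C hC z =>
    le_min zero_le_one (div_nonneg (add_nonneg (hf0 z) hb0) (by positivity))
  have htail : ∀ C, 0 < C → ∀ t, (iter K L₀ t).toOuterMeasure {z | C < ∑ n, (z.1 n : ℝ)}
      ≤ ev L₀ fun z => ENNReal.ofReal (g C z) := by
    intro C hC t
    have h1 : iter K L₀ t = L₀.bind fun z => iter K (PMF.pure z) t := by
      rw [← iter_bind, PMF.bind_pure]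
    rw [toOuterMeasure_eq_ev, h1, ev_bind]
    refine ev_mono _ fun z => ?_
    rw [ENNReal.ofReal_min, ENNReal.ofReal_one]
    refine le_min ?_ ?_
    · refine (ev_mono _ (g := fun _ => 1) fun y => ?_).trans (ev_const _ _).le
      exact Set.indicator_le_self' (fun _ _ => zero_le) y
    · rw [ENNReal.ofReal_div_of_pos (by positivity), ENNReal.le_div_iff_mul_le
        (Or.inl (by simp; positivity)) (Or.inl ENNReal.ofReal_ne_top), mul_comm, ← ev_const_mul]
      refine (ev_mono _ fun y => ?_).trans (hit z t)
      by_cases hy : y ∈ {z : State N | C < ∑ n, (z.1 n : ℝ)}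
      · rw [Set.indicator_of_mem hy, Pi.one_apply, mul_one]
        refine ENNReal.ofReal_le_ofReal (le_trans ?_ (hf y))
        exact mul_le_mul_of_nonneg_left (le_of_lt hy) hc.le
      · rw [Set.indicator_of_notMem hy, mul_zero]
        exact zero_le
  have hlim : Tendsto (fun C : ℝ => ∑' z, (L₀ z).toReal * g C z) atTop (𝓝 0) := by
    have h1 := tendsto_tsum_of_dominated_convergence (𝓕 := (atTop : Filter ℝ))
      (f := fun C z => (L₀ z).toReal * g C z) (g := fun _ => 0) (summable_toReal L₀)
      (fun z => by
        have h2 : Tendsto (fun C : ℝ => (f z + b') / (c * C)) atTop (𝓝 0) :=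
          (tendsto_const_nhds).div_atTop (tendsto_id.const_mul_atTop hc)
        have h3 := ((tendsto_const_nhds (x := (1 : ℝ))).min h2).const_mul (L₀ z).toReal
        simpa using h3)
      (by
        filter_upwards [eventually_gt_atTop 0] with C hC z
        rw [Real.norm_eq_abs, abs_of_nonneg (mul_nonneg ENNReal.toReal_nonneg (hg0 C hC z))]
        exact mul_le_of_le_one_right ENNReal.toReal_nonneg (min_le_left _ _))
    simpa using h1
  refine Tendsto.limsup_eq ?_
  have hlim' := ENNReal.tendsto_ofReal hlim
  rw [ENNReal.ofReal_zero] at hlim'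
  refine tendsto_of_tendsto_of_tendsto_of_le_of_le' tendsto_const_nhds hlim'
    (Eventually.of_forall fun _ => zero_le) ?_
  filter_upwards [eventually_gt_atTop 0] with C hC
  rw [← LoadBalancing.ev_ofReal L₀ (hg0 C hC) (summable_of_abs_le L₀ (g := fun _ => 1)
    (fun z => by rw [abs_of_nonneg (hg0 C hC z)]; exact min_le_left _ _)
    ((summable_toReal L₀).mul_right 1))]
  exact limsup_le_of_le (by isBoundedDefault) (Eventually.of_forall (htail C hC))

/-! ### Throughput optimality -/

/-- Euclidean norm of the vector of queue lengths. -/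
def queueNorm {N : ℕ} (q : Queues N) : ℝ := √(∑ n, (q n : ℝ) ^ 2)

theorem sq_queueNorm {N : ℕ} (q : Queues N) : queueNorm q ^ 2 = ∑ n, (q n : ℝ) ^ 2 :=
  Real.sq_sqrt (Finset.sum_nonneg fun _ _ => sq_nonneg _)

theorem queueNorm_nonneg {N : ℕ} (q : Queues N) : 0 ≤ queueNorm q := Real.sqrt_nonneg _

theorem le_queueNorm {N : ℕ} (q : Queues N) (n : Fin N) : (q n : ℝ) ≤ queueNorm q :=
  Real.le_sqrt_of_sq_le (Finset.single_le_sum (f := fun n => (q n : ℝ) ^ 2)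
    (fun _ _ => sq_nonneg _) (Finset.mem_univ n))

theorem total_le_queueNorm {N : ℕ} (q : Queues N) : total q ≤ N * queueNorm q := by
  calc total q ≤ ∑ _n : Fin N, queueNorm q := Finset.sum_le_sum fun n _ => le_queueNorm q n
    _ = _ := by simp

theorem queueNorm_le_total {N : ℕ} (q : Queues N) : queueNorm q ≤ total q := by
  refine Real.sqrt_le_iff.2 ⟨total_nonneg q, ?_⟩
  rw [sq, total, Finset.sum_mul]
  refine Finset.sum_le_sum fun n _ => ?_
  rw [sq]
  exact mul_le_mul_of_nonneg_left (Finset.single_le_sum (f := fun n => (q n : ℝ))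
    (fun _ _ => Nat.cast_nonneg _) (Finset.mem_univ n)) (Nat.cast_nonneg _)

theorem queueNorm_le_add {N : ℕ} (hN : 0 < N) {q q' : Queues N} {M : ℝ}
    (h : ∀ n, |(q' n : ℝ) - q n| ≤ M) : queueNorm q' ≤ queueNorm q + N * M := by
  have hM : 0 ≤ M := (abs_nonneg _).trans (h ⟨0, hN⟩)
  have hN1 : (1 : ℝ) ≤ N := by exact_mod_cast hN
  refine Real.sqrt_le_iff.2 ⟨add_nonneg (queueNorm_nonneg q) (by positivity), ?_⟩
  have h1 : ∑ n, (q' n : ℝ) ^ 2 ≤ ∑ n, ((q n : ℝ) ^ 2 + 2 * M * q n + M ^ 2) :=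
    Finset.sum_le_sum fun n _ => by
      have h2 : (q' n : ℝ) ≤ q n + M := by linarith [(abs_le.1 (h n)).2]
      have h3 : (0 : ℝ) ≤ q' n := Nat.cast_nonneg _
      nlinarith
  simp only [Finset.sum_add_distrib, ← Finset.mul_sum, Finset.sum_const, Finset.card_univ,
    Fintype.card_fin, nsmul_eq_mul, ← sq_queueNorm q] at h1
  have h4 := mul_le_mul_of_nonneg_left (total_le_queueNorm q) hM
  rw [total] at h4
  have h5 : (N : ℝ) * M ^ 2 ≤ N ^ 2 * M ^ 2 := by
    gcongr
    nlinarith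
  nlinarith

/-- The quadratic drift alone bounds time averages only. The norm has bounded increments and drift
at most `-a` outside a ball, so its exponential with small `θ` contracts geometrically, which bounds
every single time. -/
theorem throughputOptimal_powerOfD {N d : ℕ} (hd : 2 ≤ d) (hdN : d ≤ N) (μ : ℝ) :
    ThroughputOptimal (powerOfD N d hd hdN) (fun _ => μ) := by
  intro S Smax hS ε hε A Amax hA ν
  have hN : 0 < N := by omega
  have hNr : (0 : ℝ) < N := by exact_mod_cast hN
  have h := powerOfD_finiteRep hd hdN hA hS
  have hdrift := drift_sum_sq hd hdN hA hS
  have hsum : ∑ _n : Fin N, μ = N * μ := by simp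
  simp only [hsum, sub_sub_cancel] at hdrift
  set M : ℝ := (Amax : ℝ) + Smax with hM
  have hM0 : 0 ≤ M := by positivity
  -- The added `1`, here and in `R`, only ensures positivity.
  set B : ℝ := N * M + 1 with hB
  have hB0 : 0 < B := by positivity
  set a : ℝ := ε / (2 * N) with ha
  have ha0 : 0 < a := by positivity
  -- The first bound keeps exponents in the range where `|exp x - 1 - x| ≤ x²`; the second gives `(θ
  -- B)² ≤ θ a / 2`, half of the linear gain `θ a`.
  set θ : ℝ := min (1 / B) (a / (2 * B ^ 2)) with hθ
  have hθ0 : 0 < θ := lt_min (by positivity) (by positivity)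
  have hθ1 : θ * B ≤ 1 := by
    rw [← le_div_iff₀ hB0]; exact min_le_left _ _
  have hθ2 : θ * (2 * B ^ 2) ≤ a := by
    rw [← le_div_iff₀ (by positivity)]; exact min_le_right _ _
  set R : ℝ := N ^ 2 * M ^ 2 / ε + 1 with hR
  have hinc : ∀ z, ∀ ω ∈ innovations N Amax Smax,
      |queueNorm (move z ω).1 - queueNorm z.1| ≤ B := by
    intro z ω hω
    have h1 := abs_nextQueues_sub_le (mem_slots_of_mem_innovations hω) z.1
    have h2 : queueNorm (move z ω).1 ≤ queueNorm z.1 + N * M := queueNorm_le_add hN h1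
    have h3 : queueNorm z.1 ≤ queueNorm (move z ω).1 + N * M :=
      queueNorm_le_add hN fun n => by rw [abs_sub_comm]; exact h1 n
    rw [abs_le]
    constructor <;> linarith
  have hnorm : ∀ z : State N, R ≤ queueNorm z.1 →
      ∑ ω ∈ innovations N Amax Smax, weight hd hdN A S z ω *
        (queueNorm (move z ω).1 - queueNorm z.1) ≤ -a := by
    intro z hz
    have hR0 : 0 < R := by positivity
    have hr0 : 0 < queueNorm z.1 := hR0.trans_le hz
    -- Uses `2 r (r' - r) ≤ r'² - r²` to pass from the drift of the square to that of the norm;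
    -- beyond `R` half of the negative drift absorbs `N M²`, and dividing by `2 r` leaves `-ε / (2
    -- N) = -a`.
    have h1 : ∑ ω ∈ innovations N Amax Smax, weight hd hdN A S z ω *
        ((queueNorm (move z ω).1 - queueNorm z.1) * (2 * queueNorm z.1))
        ≤ N * M ^ 2 - 2 * ε / N * total z.1 := by
      refine (h.sum_mono z fun ω _ => ?_).trans (hdrift z)
      rw [← sq_queueNorm, ← sq_queueNorm]
      nlinarith [sq_nonneg (queueNorm (move z ω).1 - queueNorm z.1)]
    simp only [← mul_assoc] at h1
    rw [← Finset.sum_mul, ← Finset.sum_mul] at h1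
    have h2 : 2 * ε / N * queueNorm z.1 ≤ 2 * ε / N * total z.1 :=
      mul_le_mul_of_nonneg_left (queueNorm_le_total _) (by positivity)
    have h3 : N * M ^ 2 ≤ ε / N * queueNorm z.1 := by
      have h4 : N ^ 2 * M ^ 2 / ε ≤ queueNorm z.1 := by linarith
      calc N * M ^ 2 = ε / N * (N ^ 2 * M ^ 2 / ε) := by field_simp
        _ ≤ _ := mul_le_mul_of_nonneg_left h4 (by positivity)
    have h5 : 2 * ε / N = 4 * a := by rw [ha]; field_simp; ring
    have h6 : ε / N = 2 * a := by rw [ha]; field_simp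
    rw [h5] at h1 h2
    rw [h6] at h3
    by_contra! hcon
    nlinarith [mul_lt_mul_of_pos_right hcon hr0]
  have hstable := h.stable (f := fun z => Real.exp (θ * queueNorm z.1))
    -- The maximum with `0` only secures `0 ≤ ρ`; `b` bounds the value one step after a state inside
    -- the ball of radius `R`.
    (ρ := max (1 - θ * a / 2) 0) (b := Real.exp (θ * (R + B))) (c := θ / N) (le_max_right _ _)
    (max_lt (by nlinarith) zero_lt_one) (Real.exp_nonneg _) (by positivity)
    (fun z => by
      have h1 : θ / N * total z.1 ≤ θ * queueNorm z.1 := by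
        rw [div_mul_eq_mul_div, mul_div_assoc]
        refine mul_le_mul_of_nonneg_left ?_ hθ0.le
        rw [div_le_iff₀ hNr, mul_comm]
        exact total_le_queueNorm _
      linarith [Real.add_one_le_exp (θ * queueNorm z.1)])
    (fun z => by
      rcases lt_or_ge (queueNorm z.1) R with hz | hz
      · refine le_trans ?_ (le_add_of_nonneg_left (mul_nonneg (le_max_right _ _)
          (Real.exp_nonneg _)))
        refine (h.sum_mono z fun ω hω => ?_).trans (h.sum_const z _).le
        refine Real.exp_le_exp.2 (mul_le_mul_of_nonneg_left ?_ hθ0.le)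
        linarith [(abs_le.1 (hinc z ω hω)).2]
      · refine le_trans ?_ (le_add_of_nonneg_right (Real.exp_nonneg _))
        set r := queueNorm z.1 with hr
        calc _ ≤ ∑ ω ∈ innovations N Amax Smax, weight hd hdN A S z ω *
              (Real.exp (θ * r) * (1 + θ * (queueNorm (move z ω).1 - r) + (θ * B) ^ 2)) := by
              refine h.sum_mono z fun ω hω => ?_
              set Δ := queueNorm (move z ω).1 - r with hΔ
              have h1 : θ * queueNorm (move z ω).1 = θ * r + θ * Δ := by rw [hΔ]; ring
              rw [h1, Real.exp_add]
              refine mul_le_mul_of_nonneg_left ?_ (Real.exp_nonneg _)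
              have h2 : |θ * Δ| ≤ θ * B := by
                rw [abs_mul, abs_of_pos hθ0]
                exact mul_le_mul_of_nonneg_left (hinc z ω hω) hθ0.le
              have h3 := (abs_le.1 (Real.abs_exp_sub_one_sub_id_le (h2.trans hθ1))).2
              have h4 : (θ * Δ) ^ 2 ≤ (θ * B) ^ 2 := by
                rw [← sq_abs]; gcongr
              linarith
          _ = Real.exp (θ * r) * (1 + θ * (∑ ω ∈ innovations N Amax Smax,
              weight hd hdN A S z ω * (queueNorm (move z ω).1 - r)) + (θ * B) ^ 2) := by
              have h1 : ∀ ω, weight hd hdN A S z ω *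
                  (Real.exp (θ * r) * (1 + θ * (queueNorm (move z ω).1 - r) + (θ * B) ^ 2))
                  = weight hd hdN A S z ω * (Real.exp (θ * r) * (1 + (θ * B) ^ 2))
                    + Real.exp (θ * r) * θ *
                      (weight hd hdN A S z ω * (queueNorm (move z ω).1 - r)) := fun ω => by ring
              rw [Finset.sum_congr rfl fun ω _ => h1 ω, Finset.sum_add_distrib, h.sum_const,
                ← Finset.mul_sum]
              ring
          _ ≤ max (1 - θ * a / 2) 0 * Real.exp (θ * r) := by
              rw [mul_comm (max _ _)]
              refine mul_le_mul_of_nonneg_left (le_max_of_le_left ?_) (Real.exp_nonneg _)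
              nlinarith [mul_le_mul_of_nonneg_left (hnorm z hz) hθ0.le,
                mul_le_mul_of_nonneg_left hθ2 hθ0.le])
    (lawAt (powerOfD N d hd hdN) A S ν 0)
  rwa [← funext (lawAt_eq_iter (powerOfD N d hd hdN) A S ν)] at hstable

end LoadBalancing

end

theorem mainTheorem7 (N d : ℕ) (hd : 2 ≤ d) (hdN : d ≤ N) (μ : ℝ) (hμ : 0 < μ) :
    (∀ z : LoadBalancing.State N, Function.Injective z.1 →
      ∀ σ : Equiv.Perm (Fin N), LoadBalancing.IsSorting z.1 σ →
        LoadBalancing.sortedDispatch (LoadBalancing.powerOfD N d hd hdN) z σ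
          = LoadBalancing.powerOfDProb N d) ∧
    (∀ z : LoadBalancing.State N,
      ∀ σ : Equiv.Perm (Fin N), LoadBalancing.IsSorting z.1 σ →
        LoadBalancing.InnerEquiv z.1 σ
          (LoadBalancing.sortedDispatch (LoadBalancing.powerOfD N d hd hdN) z σ)
          (LoadBalancing.powerOfDProb N d)) ∧
    (∀ σ : Equiv.Perm (Fin N),
      LoadBalancing.DeltaTilted (1 / (N : ℝ)) (fun _ => μ) σ (LoadBalancing.powerOfDProb N d)) ∧
    LoadBalancing.InPi (LoadBalancing.powerOfD N d hd hdN) (fun _ => μ) ∧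
    LoadBalancing.ThroughputOptimal (LoadBalancing.powerOfD N d hd hdN) (fun _ => μ) ∧
    LoadBalancing.HeavyTrafficDelayOptimal (LoadBalancing.powerOfD N d hd hdN) (fun _ => μ) :=
  ⟨fun z hz _ hσ => LoadBalancing.sortedDispatch_powerOfD hd hdN z hz hσ,
    fun z _ hσ => LoadBalancing.innerEquiv_powerOfD hd hdN z hσ,
    fun σ => LoadBalancing.deltaTilted_powerOfD hd hdN hμ σ,
    LoadBalancing.inPi_powerOfD hd hdN hμ,
    LoadBalancing.throughputOptimal_powerOfD hd hdN μ,
    LoadBalancing.heavyTrafficDelayOptimal_powerOfD hd hdN hμ⟩
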